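/- **Theorem (All buckets filled with high probability).** Let $w\ge 2$ be an integer and $B>0$ real. Partition $[-B/2,B/2)$ into the $w$ half-open buckets $\mathcal I_i=[-B/2+i\,B/w,\,-B/2+(i+1)B/w)$, $0\le i<w$. Phase A processes numbers $s_1,s_2,\dots$ as follows. Start with $A_0=\{0\}$. Given $A_{j-1}$, form the list of all $x$ and all $x+s_j$ with $x\in A_{j-1}$, discard the elements outside $[-B/2,B/2)$, and let $A_j$ consist of one element per nonempty bucket, chosen uniformly at random among the listed elements in that bucket (with fresh independent randomness, independent of the $s_j$). For $\delta\in(0,1)$ put $$j_{\mathrm{half}}:=\lfloor 4\ln(w-1)\rfloor,\qquad t_\delta:=\left\lceil\frac{\ln(w/(2\delta))}{\ln(8/7)}\right\rceil,\qquad j_\delta:=j_{\mathrm{half}}+t_\delta .$$ There is an absolute constant $C>0$ such that the following holds for all such $w$ and $B$. 1. *(Filling.)* If $s_1,s_2,\dots$ are i.i.d. uniform on $(-B,B)$, then for every $\delta\in(0,1)$ and every $j\ge j_\delta$ one has $\Pr(|A_j|<w)\le\delta$, and $$j_\delta\le 4\ln w+\frac{\ln(w/(2\delta))}{\ln(8/7)}+1\le\Bigl(4+\frac1{\ln(8/7)}\Bigr)\ln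 w+\frac{\ln(1/\delta)}{\ln(8/7)}+1\le 11.489\ln w+7.489\ln(1/\delta)+1 .$$ Moreover there is an iteration index $j\le 7.96\log_2 w+5.19\log_2(1/\delta)+1$ with $\Pr(|A_j|<w)\le\delta$. 2. *(Mesh.)* For all values of the input and of the random choices and for every $n$: every element of $A_n$ is a subset sum of $s_1,\dots,s_n$, and if $|A_n|=w$ then every bucket contains an element of $A_n$, and every point of $[-B/2,B/2]$ is within $B/w$ of an element of $A_n$. 3. *(Time and state.)* Always $|A_n|\le w$. On a unit-cost random-access machine over the reals (arithmetic, comparison, rounding down, memory access, loop iteration, and reading the next input or random number each cost one unit of time), an explicit program for Phase A computes $A_n$ in time at most $C\,w\,(n+1)$ using at most $C\,w$ memory cells. In particular, for $n=j_\delta$, and also for $n=j$ with some index $j$ as in the last sentence of item 1, the time is at most $C\,(1+\log_2(1/\delta))\,w\log_2 w$, which is $O(w\log w)$ for fixed $\delta$. -/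

import Mathlib

open MeasureTheory ProbabilityTheory

universe u

/-! ### The random process of Phase A -/

/-- The `i`-th of the `w` half-open buckets of width `B / w` that partition `[-B/2, B/2)`. -/
def bucket (w : ℕ) (B : ℝ) (i : Fin w) : Set ℝ :=
  Set.Ico (-B / 2 + (i : ℝ) * (B / w)) (-B / 2 + ((i : ℝ) + 1) * (B / w))

/-- A trimmed state: for every bucket, the element kept there, if any. -/
abbrev Beam (w : ℕ) : Type := Fin w → Option ℝ

/-- The kept elements, listed by bucket. -/
def Beam.toList {w : ℕ} (A : Beam w) : List ℝ := (List.finRange w).filterMap A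

/-- The set of anchors of a state. -/
def Beam.anchors {w : ℕ} (A : Beam w) : Set ℝ := {a | ∃ i, A i = some a}

/-- Include / exclude the next number `s`: all `x` and all `x + s`. -/
def Beam.expand {w : ℕ} (A : Beam w) (s : ℝ) : List ℝ :=
  A.toList ++ A.toList.map (fun x => x + s)

open scoped Classical in
/-- The elements of the expanded list that lie in bucket `i`. -/
noncomputable def Beam.candidates {w : ℕ} (B : ℝ) (A : Beam w) (s : ℝ) (i : Fin w) : List ℝ :=
  (A.expand s).filter (fun x => x ∈ bucket w B i)

/-- The entry of `l` selected by `r`, and `none` if `l` is empty. For `r` uniform on `[0, 1]` every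
position of `l` is selected with the same probability. -/
noncomputable def pick (r : ℝ) (l : List ℝ) : Option ℝ :=
  l[min ⌊r * (l.length : ℝ)⌋₊ (l.length - 1)]?

/-- One iteration: expand by `s`, then keep one random candidate in each nonempty bucket. -/
noncomputable def Beam.step {w : ℕ} (B : ℝ) (A : Beam w) (s : ℝ) (r : Fin w → ℝ) : Beam w :=
  fun i => pick (r i) (A.candidates B s i)

open scoped Classical in
/-- The state after `j` iterations, started from `{0}`. The numbers are `s 0, s 1, …`; iteration
`j + 1` uses the number `s j` and, for bucket `i`, the random number `r (j * w + i)`. -/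
noncomputable def phaseA (w : ℕ) (B : ℝ) (s r : ℕ → ℝ) : ℕ → Beam w
  | 0 => fun i => if (0 : ℝ) ∈ bucket w B i then some 0 else none
  | j + 1 => (phaseA w B s r j).step B (s j) (fun i => r (j * w + i))

/-- `s 0, s 1, …` are uniform on `[-B, B]`, `r 0, r 1, …` are uniform on `[0, 1]`, and all these
variables together are independent. -/
structure IsPhaseAInput {Ω : Type u} [MeasurableSpace Ω] (P : Measure Ω) (B : ℝ)
    (s r : ℕ → Ω → ℝ) : Prop where
  measurable_s : ∀ j, Measurable (s j)
  measurable_r : ∀ k, Measurable (r k)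
  uniform_s : ∀ j, pdf.IsUniform (s j) (Set.Icc (-B) B) P volume
  uniform_r : ∀ k, pdf.IsUniform (r k) (Set.Icc 0 1) P volume
  indep : iIndepFun (Sum.elim s r : ℕ ⊕ ℕ → Ω → ℝ) P

/-- Every point of `[-B/2, B/2]` is within `ε` of `A`. -/
def IsMesh (A : Set ℝ) (B ε : ℝ) : Prop :=
  ∀ x ∈ Set.Icc (-B / 2) (B / 2), ∃ a ∈ A, |x - a| ≤ ε

/-! ### The iteration counts -/

/-- The explicit half-coverage index: the solution `t = 4 ln (w - 1)` of
`1 / (1 + (w - 1) exp (-t / 4)) = 1 / 2`, rounded down to an integer. -/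
noncomputable def jHalf (w : ℕ) : ℕ := ⌊4 * Real.log ((w : ℝ) - 1)⌋₊

noncomputable def tDelta (w : ℕ) (δ : ℝ) : ℕ :=
  ⌈Real.log ((w : ℝ) / (2 * δ)) / Real.log (8 / 7)⌉₊

noncomputable def jDelta (w : ℕ) (δ : ℝ) : ℕ := jHalf w + tDelta w δ

/-! ### A unit-cost random-access machine over the reals

Every arithmetic operation, comparison, rounding, memory access, loop iteration and input access
costs one unit of time. The two inputs (the numbers and the random numbers) are read-once streams.
The space used is one more than the largest memory address accessed. -/

structure RAM where
  mem : ℕ → ℝ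
  time : ℕ
  space : ℕ
  /-- the stream of input numbers that have not been read yet is `items itemPos, …` -/
  items : ℕ → ℝ
  itemPos : ℕ
  /-- the stream of random numbers that have not been read yet is `coins coinPos, …` -/
  coins : ℕ → ℝ
  coinPos : ℕ

abbrev Prog (α : Type) : Type := StateM RAM α

namespace Prog

def tick : Prog Unit := modify fun m => { m with time := m.time + 1 }

/-- A register operation with result `a`. -/
def op {α : Type} (a : α) : Prog α := do
  tick
  return a

noncomputable def add (x y : ℝ) : Prog ℝ := op (x + y)

noncomputable def mul (x y : ℝ) : Prog ℝ := op (x * y)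

noncomputable def div (x y : ℝ) : Prog ℝ := op (x / y)

noncomputable def neg (x : ℝ) : Prog ℝ := op (-x)

noncomputable def le (x y : ℝ) : Prog Bool := op (decide (x ≤ y))

noncomputable def lt (x y : ℝ) : Prog Bool := op (decide (x < y))

noncomputable def floor (x : ℝ) : Prog ℕ := op ⌊x⌋₊

def minNat (k l : ℕ) : Prog ℕ := op (min k l)

def predNat (k : ℕ) : Prog ℕ := op (k - 1)

def load (a : ℕ) : Prog ℝ := do
  tick
  modify fun m => { m with space := max m.space (a + 1) }
  return (← get).mem a

def store (a : ℕ) (x : ℝ) : Prog Unit := do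
  tick
  modify fun m => { m with mem := Function.update m.mem a x, space := max m.space (a + 1) }

def readItem : Prog ℝ := do
  tick
  let m ← get
  set { m with itemPos := m.itemPos + 1 }
  return m.items m.itemPos

def readCoin : Prog ℝ := do
  tick
  let m ← get
  set { m with coinPos := m.coinPos + 1 }
  return m.coins m.coinPos

/-- `for i = 0, …, n - 1 do body i` -/
def forLoop : ℕ → (ℕ → Prog Unit) → Prog Unit
  | 0, _ => return ()
  | n + 1, body => do
    forLoop n body
    tick
    body n

/-! The memory holds a record of six cells for each bucket `i`: `6 * i` is a flag (`1` if an anchor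
is kept, else `0`), `6 * i + 1` the anchor, `6 * i + 2` the number of candidates, and
`6 * i + 3, 6 * i + 4, 6 * i + 5` the candidates. (Anchors of three different buckets are more than
one bucket width apart, so that a bucket never gets more than three candidates.) -/

/-- Append `x` to the candidates of its bucket, and discard it if it lies outside `[-B/2, B/2)`.
Here `h = B / 2` and `Δ = B / w`. -/
noncomputable def place (h Δ x : ℝ) : Prog Unit := do
  let h' ← neg h
  if ← le h' x then
    if ← lt x h then
      let y ← add x h
      let q ← div y Δ
      let i ← floor q
      let c ← load (6 * i + 2)
      let k ← floor c
      store (6 * i + 3 + k) x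
      let c' ← add c 1
      store (6 * i + 2) c'

noncomputable def setup (w : ℕ) (h Δ : ℝ) : Prog Unit := do
  forLoop w fun i => store (6 * i) 0
  let q ← div h Δ
  let i ← floor q
  store (6 * i) 1
  store (6 * i + 1) 0

/-- The anchors become the first candidates of their buckets. -/
noncomputable def keepOld (w : ℕ) : Prog Unit :=
  forLoop w fun i => do
    let f ← load (6 * i)
    if ← lt 0 f then
      let a ← load (6 * i + 1)
      store (6 * i + 3) a
      store (6 * i + 2) 1
    else
      store (6 * i + 2) 0

/-- The shifted anchors are distributed to the buckets. -/
noncomputable def placeShifted (w : ℕ) (h Δ s : ℝ) : Prog Unit :=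
  forLoop w fun i => do
    let f ← load (6 * i)
    if ← lt 0 f then
      let a ← load (6 * i + 1)
      let x ← add a s
      place h Δ x

/-- One random candidate is kept in each nonempty bucket. -/
noncomputable def trim (w : ℕ) : Prog Unit :=
  forLoop w fun i => do
    let r ← readCoin
    let c ← load (6 * i + 2)
    if ← lt 0 c then
      let y ← mul r c
      let k ← floor y
      let n ← floor c
      let n' ← predNat n
      let k' ← minNat k n'
      let a ← load (6 * i + 3 + k')
      store (6 * i + 1) a
      store (6 * i) 1

/-- `n` iterations of Phase A. -/
noncomputable def program (w : ℕ) (B : ℝ) (n : ℕ) : Prog Unit := do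
  let h ← div B 2
  let Δ ← div B w
  setup w h Δ
  forLoop n fun _ => do
    let s ← readItem
    keepOld w
    placeShifted w h Δ s
    trim w

end Prog

/-- The machine after `n` iterations on the numbers `s` and the random numbers `r`. -/
noncomputable def runPhaseA (w : ℕ) (B : ℝ) (s r : ℕ → ℝ) (n : ℕ) : RAM :=
  (StateT.run (Prog.program w B n)
    { mem := fun _ => 0, time := 0, space := 0,
      items := s, itemPos := 0, coins := r, coinPos := 0 } : Id (Unit × RAM)).2

/-- The state of Phase A that is stored in the memory. -/
noncomputable def RAM.beam (w : ℕ) (m : RAM) : Beam w :=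
  fun i => if m.mem (6 * i) = 0 then none else some (m.mem (6 * i + 1))

/-! ### Buckets -/

/-! Write the next number as s = -B + k·B/w + θ with 0 ≤ θ < B/w and k in {0, …, 2w-1}, and fix θ.
Adding θ moves the anchor of bucket b into cell e(b), which is b or b+1; the choice of k then
translates all these cells rigidly. Let N be the number of occupied buckets, K the number of
distinct values of e on them, and F the number of buckets newly filled. Every empty bucket is hit
for exactly K of the 2w values of k, so F sums to (w-N)K over k (`sum_card_newlyHit`). Moreover N/2
≤ K ≤ N, F ≤ K and N+F ≤ w. Occupied buckets stay occupied, and the trimming decides only which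
element is kept, so these bounds hold for every past and every coin outcome.

A function V of N with V(N+F) ≤ V(N)(1 - 2wρF/(K(w-N))) therefore shrinks by the factor 1-ρ in
expectation: the bound is linear in F and can be averaged over k and θ (`IsPotential.sum_le`,
`IsPotential.lintegral_step_le`). If V ≥ c > 0 at all non-full counts, Markov's inequality bounds
the failure probability by (1-ρ)^j V(1)/c (`IsPotential.prob_le`).

Two potentials are used. The ratio (w-N)/N has ρ = 1/6 and V(1)/c = (w-1)^2, which gives the bound
in base-2 logarithms. The function √(w-N)·N^(-6/7) has ρ = 1/8 and V(1)/c = (w-1)^(19/14). For the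
explicit index `jDelta` one needs V(1)/c ≤ (w/2)(8/7)^`jHalf` (`exists_isPotential`): asymptotics
settle w ≥ 129, and an exact integer computation with a lowered value V(1) settles 3 ≤ w ≤ 128.

The machine part is a verification by loop invariants. Its geometric input is that a bucket receives
at most three candidates, so a fixed record per bucket suffices and an iteration costs O(w). -/

/-- The index of the cell of width `B / w` that contains `x`; the cells `0, …, w - 1` are the
buckets. -/
noncomputable def cell (w : ℕ) (B x : ℝ) : ℤ := ⌊(x + B / 2) / (B / w)⌋

theorem mem_bucket_iff_cell {w : ℕ} {B : ℝ} (hB : 0 < B) (i : Fin w) (x : ℝ) :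
    x ∈ bucket w B i ↔ cell w B x = (i : ℕ) := by
  have hw : (0 : ℝ) < w := by exact_mod_cast i.pos
  have hd : 0 < B / w := by positivity
  rw [cell, Int.floor_eq_iff, le_div_iff₀ hd, div_lt_iff₀ hd, bucket, Set.mem_Ico]
  push_cast
  constructor <;> rintro ⟨h1, h2⟩ <;> constructor <;> linarith

theorem cell_add_mul {w : ℕ} {B : ℝ} (hB : 0 < B) (hw : 0 < w) (x : ℝ) (k : ℤ) :
    cell w B (x + k * (B / w)) = cell w B x + k := by
  have hw' : (0 : ℝ) < w := by exact_mod_cast hw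
  have hd : B / w ≠ 0 := by positivity
  rw [cell, cell, ← Int.floor_add_intCast]
  congr 1
  field_simp
  ring

/-- A shift by less than one cell width crosses at most one cell boundary. Both the bound N ≤ 2K and
the bound of three candidates per bucket rest on this. -/
theorem cell_add_cases {w : ℕ} {B : ℝ} (hB : 0 < B) (hw : 0 < w) (x : ℝ) {θ : ℝ}
    (h0 : 0 ≤ θ) (h1 : θ < B / w) :
    cell w B (x + θ) = cell w B x ∨ cell w B (x + θ) = cell w B x + 1 := by
  have hw' : (0 : ℝ) < w := by exact_mod_cast hw
  have hd : 0 < B / w := by positivity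
  have h2 : cell w B x ≤ cell w B (x + θ) := by
    apply Int.floor_le_floor
    gcongr
    linarith
  have h3 : cell w B (x + θ) ≤ cell w B x + 1 := by
    have h := cell_add_mul hB hw x 1
    rw [← h]
    apply Int.floor_le_floor
    gcongr
    push_cast
    linarith
  omega

theorem mem_Ico_iff_cell {w : ℕ} {B : ℝ} (hB : 0 < B) (hw : 0 < w) (x : ℝ) :
    x ∈ Set.Ico (-(B / 2)) (B / 2) ↔ 0 ≤ cell w B x ∧ cell w B x < w := by
  have hw' : (0 : ℝ) < w := by exact_mod_cast hw
  have hd : 0 < B / w := by positivity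
  rw [cell, Int.floor_nonneg, Int.floor_lt, Set.mem_Ico]
  push_cast
  rw [div_lt_iff₀ hd, mul_div_cancel₀ _ hw'.ne']
  constructor
  · rintro ⟨h1, h2⟩
    exact ⟨div_nonneg (by linarith) hd.le, by linarith⟩
  · rintro ⟨h1, h2⟩
    rw [le_div_iff₀ hd, zero_mul] at h1
    exact ⟨by linarith, by linarith⟩

theorem exists_mem_bucket {w : ℕ} {B : ℝ} (hB : 0 < B) (hw : 0 < w) {x : ℝ}
    (hx : x ∈ Set.Ico (-(B / 2)) (B / 2)) : ∃ i, x ∈ bucket w B i := by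
  obtain ⟨h0, h1⟩ := (mem_Ico_iff_cell hB hw x).1 hx
  refine ⟨⟨(cell w B x).toNat, by omega⟩, (mem_bucket_iff_cell hB _ x).2 ?_⟩
  simp [h0]

theorem zero_mem_Ico_half {B : ℝ} (hB : 0 < B) : (0 : ℝ) ∈ Set.Ico (-(B / 2)) (B / 2) :=
  ⟨by linarith, by linarith⟩

/-! ### States -/

theorem pick_nil (r : ℝ) : pick r [] = none := by simp [pick]

theorem exists_pick_eq (r : ℝ) {l : List ℝ} (hl : l ≠ []) : ∃ a ∈ l, pick r l = some a := by
  have h : 0 < l.length := List.length_pos_iff.2 hl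
  have h' : min ⌊r * (l.length : ℝ)⌋₊ (l.length - 1) < l.length := by omega
  exact ⟨_, List.getElem_mem h', by rw [pick, List.getElem?_eq_getElem h']⟩

theorem mem_of_pick_eq {r : ℝ} {l : List ℝ} {a : ℝ} (h : pick r l = some a) : a ∈ l :=
  List.mem_of_getElem? h

theorem pick_eq_none_iff {r : ℝ} {l : List ℝ} : pick r l = none ↔ l = [] := by
  refine ⟨fun h => ?_, fun h => h ▸ pick_nil r⟩
  by_contra hl
  obtain ⟨a, -, ha⟩ := exists_pick_eq r hl
  simp [h] at ha

namespace Beam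

variable {w : ℕ}

/-- Every kept element lies in its bucket. -/
def Consistent (B : ℝ) (A : Beam w) : Prop := ∀ i a, A i = some a → a ∈ bucket w B i

theorem mem_toList {A : Beam w} {x : ℝ} : x ∈ A.toList ↔ ∃ i, A i = some x := by
  simp [toList]

theorem mem_candidates {B : ℝ} {A : Beam w} {s : ℝ} {i : Fin w} {x : ℝ} :
    x ∈ A.candidates B s i ↔
      (∃ b a, A b = some a ∧ (x = a ∨ x = a + s)) ∧ x ∈ bucket w B i := by
  simp only [candidates, expand, List.mem_filter, List.mem_append, List.mem_map, mem_toList,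
    decide_eq_true_eq]
  refine and_congr_left fun _ => ⟨?_, ?_⟩
  · rintro (⟨b, hb⟩ | ⟨a, ⟨b, hb⟩, rfl⟩)
    exacts [⟨b, x, hb, Or.inl rfl⟩, ⟨b, a, hb, Or.inr rfl⟩]
  · rintro ⟨b, a, hb, rfl | rfl⟩
    exacts [Or.inl ⟨b, hb⟩, Or.inr ⟨a, ⟨b, hb⟩, rfl⟩]

theorem step_consistent (B : ℝ) (A : Beam w) (s : ℝ) (r : Fin w → ℝ) :
    (A.step B s r).Consistent B :=
  fun _ _ h => (mem_candidates.1 (mem_of_pick_eq h)).2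

/-- The occupied buckets. -/
def occ (A : Beam w) : Finset (Fin w) := Finset.univ.filter fun i => (A i).isSome

theorem mem_occ {A : Beam w} {i : Fin w} : i ∈ A.occ ↔ ∃ a, A i = some a := by
  simp [occ, Option.isSome_iff_exists]

theorem Consistent.index_eq {B : ℝ} (hB : 0 < B) {A : Beam w} (hA : A.Consistent B) {b i : Fin w}
    {a : ℝ} (hb : A b = some a) (ha : a ∈ bucket w B i) : b = i := by
  have h1 := (mem_bucket_iff_cell hB b a).1 (hA b a hb)
  rw [(mem_bucket_iff_cell hB i a).1 ha] at h1
  exact Fin.ext (by exact_mod_cast h1.symm)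

/-- `pick` succeeds on every nonempty list, so the coins `r` do not influence which buckets are
occupied. Old anchors are candidates for their own buckets, so occupancy is monotone. -/
theorem mem_occ_step {B : ℝ} (hB : 0 < B) {A : Beam w} (hA : A.Consistent B) {s : ℝ}
    {r : Fin w → ℝ} {i : Fin w} :
    i ∈ (A.step B s r).occ ↔
      i ∈ A.occ ∨ ∃ b a, A b = some a ∧ a + s ∈ bucket w B i := by
  have h : i ∈ (A.step B s r).occ ↔ ∃ x, x ∈ A.candidates B s i := by
    rw [mem_occ, ← Option.ne_none_iff_exists', step, Ne, pick_eq_none_iff,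
      List.eq_nil_iff_forall_not_mem]
    push Not
    rfl
  rw [h]
  simp only [mem_candidates, mem_occ]
  constructor
  · rintro ⟨x, ⟨b, a, hb, rfl | rfl⟩, hx⟩
    · exact Or.inl ⟨x, hA.index_eq hB hb hx ▸ hb⟩
    · exact Or.inr ⟨b, a, hb, hx⟩
  · rintro (⟨a, ha⟩ | ⟨b, a, hb, hx⟩)
    · exact ⟨a, ⟨i, a, ha, Or.inl rfl⟩, hA i a ha⟩
    · exact ⟨a + s, ⟨b, a, hb, Or.inr rfl⟩, hx⟩

theorem Consistent.ncard_anchors {B : ℝ} (hB : 0 < B) {A : Beam w} (hA : A.Consistent B) :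
    A.anchors.ncard = A.occ.card := by
  have himg : A.anchors = (fun i => (A i).getD 0) '' (A.occ : Set (Fin w)) := by
    ext a
    simp only [anchors, Set.mem_ofPred_eq, Set.mem_image, Finset.mem_coe, mem_occ]
    constructor
    · rintro ⟨i, hi⟩
      exact ⟨i, ⟨a, hi⟩, by simp [hi]⟩
    · rintro ⟨i, ⟨a', hi⟩, h⟩
      refine ⟨i, ?_⟩
      rw [hi] at h ⊢
      simpa using h
  rw [himg, Set.InjOn.ncard_image, Set.ncard_coe_finset]
  intro i hi j hj hij
  obtain ⟨a, ha⟩ := mem_occ.1 hi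
  obtain ⟨b, hb⟩ := mem_occ.1 hj
  simp only [ha, hb, Option.getD_some] at hij
  exact hA.index_eq hB ha (hij ▸ hA j b hb)

end Beam

/-! ### Invariants of the process: consistency, subset sums, mesh -/

section PhaseA

variable {w : ℕ} {B : ℝ}

theorem phaseA_consistent (w : ℕ) (B : ℝ) (s r : ℕ → ℝ) (n : ℕ) :
    (phaseA w B s r n).Consistent B := by
  cases n with
  | zero =>
    intro i a h
    simp only [phaseA] at h
    split_ifs at h with h0
    simpa using (Option.some.inj h) ▸ h0
  | succ n => exact Beam.step_consistent B _ _ _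

theorem card_occ_phaseA_zero (hB : 0 < B) (hw : 0 < w) (s r : ℕ → ℝ) :
    (phaseA w B s r 0).occ.card = 1 := by
  obtain ⟨i, hi⟩ := exists_mem_bucket hB hw (zero_mem_Ico_half hB)
  rw [Finset.card_eq_one]
  refine ⟨i, Finset.ext fun j => ?_⟩
  rw [Beam.mem_occ, Finset.mem_singleton]
  simp only [phaseA]
  constructor
  · rintro ⟨a, ha⟩
    split_ifs at ha with h0
    have h1 := (mem_bucket_iff_cell hB _ _).1 h0
    rw [(mem_bucket_iff_cell hB _ _).1 hi] at h1
    exact Fin.ext (by exact_mod_cast h1.symm)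
  · rintro rfl
    exact ⟨0, by simp [hi]⟩

theorem exists_subset_sum_of_mem_phaseA (w : ℕ) (B : ℝ) (s r : ℕ → ℝ) (n : ℕ) :
    ∀ i a, phaseA w B s r n i = some a →
      ∃ V : Finset ℕ, V ⊆ Finset.range n ∧ a = ∑ k ∈ V, s k := by
  induction n with
  | zero =>
    intro i a h
    simp only [phaseA] at h
    split_ifs at h
    exact ⟨∅, by simp, by simpa using h.symm⟩
  | succ n ih =>
    intro i a h
    obtain ⟨⟨b, x, hb, hx⟩, -⟩ := Beam.mem_candidates.1 (mem_of_pick_eq h)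
    obtain ⟨V, hV, rfl⟩ := ih b x hb
    rcases hx with rfl | rfl
    · exact ⟨V, hV.trans (Finset.range_mono n.le_succ), rfl⟩
    · have hn : n ∉ V := fun h => by simpa using hV h
      refine ⟨insert n V, ?_, by rw [Finset.sum_insert hn, add_comm]⟩
      rw [Finset.insert_subset_iff]
      exact ⟨by simp, hV.trans (Finset.range_mono n.le_succ)⟩

theorem Beam.isMesh_anchors {A : Beam w} (hB : 0 < B) (hw : 0 < w)
    (h : ∀ i : Fin w, ∃ a ∈ A.anchors, a ∈ bucket w B i) : IsMesh A.anchors B (B / w) := by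
  have hw' : (0 : ℝ) < w := by exact_mod_cast hw
  have hd : 0 < B / w := by positivity
  intro x hx
  rcases hx.2.lt_or_eq with hlt | rfl
  · obtain ⟨i, hi⟩ := exists_mem_bucket hB hw (x := x) ⟨by linarith [hx.1], hlt⟩
    obtain ⟨a, ha, hai⟩ := h i
    refine ⟨a, ha, abs_le.2 ?_⟩
    have h1 := hi.1
    have h2 := hi.2
    have h3 := hai.1
    have h4 := hai.2
    constructor <;> nlinarith
  -- The right endpoint `B / 2` lies in no half-open bucket; the anchor of the last bucket serves
  -- it.
  · obtain ⟨a, ha, hai⟩ := h ⟨w - 1, by omega⟩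
    refine ⟨a, ha, abs_le.2 ?_⟩
    have h3 := hai.1
    have h4 := hai.2
    have h5 : w * (B / w) = B := mul_div_cancel₀ _ hw'.ne'
    simp only [Nat.cast_sub hw, Nat.cast_succ, Nat.cast_zero] at h3 h4
    constructor <;> nlinarith

/-- The state after `n` iterations depends only on the first `n` numbers and the first `n * w`
random numbers. -/
theorem phaseA_congr {s r s' r' : ℕ → ℝ} {n : ℕ} (hs : ∀ k < n, s k = s' k)
    (hr : ∀ k < n * w, r k = r' k) : phaseA w B s r n = phaseA w B s' r' n := by
  induction n with
  | zero => rfl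
  | succ n ih =>
    have h : n * w + w = (n + 1) * w := by ring
    rw [phaseA, phaseA, ih (fun k hk => hs k (by omega)) (fun k hk => hr k (by omega)),
      hs n (by omega)]
    congr 1
    funext i
    exact hr _ (by have := i.isLt; omega)

end PhaseA

/-! ### The number of newly occupied buckets -/

section Shift

variable {w : ℕ}

/-- The buckets outside `O` that are hit when the cells `e b`, `b ∈ O`, are shifted by `k - w`. -/
def newlyHit (O : Finset (Fin w)) (e : Fin w → ℕ) (k : ℕ) : Finset (Fin w) :=
  Oᶜ.filter fun i => ∃ b ∈ O, e b + k = i + w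

/-- Double counting: for a fixed empty bucket `i`, the map `k ↦ i + w - k` is a bijection from the
shifts hitting `i` onto the image of `e` on `O`. No shift is lost at the ends of the range, because
`e` takes values in `0, …, w`. -/
theorem sum_card_newlyHit (O : Finset (Fin w)) (e : Fin w → ℕ)
    (he : ∀ b, e b = b ∨ e b = b + 1) :
    ∑ k ∈ Finset.range (2 * w), (newlyHit O e k).card = (w - O.card) * (O.image e).card := by
  have h1 : ∀ k, (newlyHit O e k).card =
      ∑ i ∈ Oᶜ, if ∃ b ∈ O, e b + k = i + w then 1 else 0 := fun k => by
    rw [newlyHit, Finset.card_filter]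
  simp_rw [h1]
  rw [Finset.sum_comm]
  have h2 : ∀ i ∈ Oᶜ, (∑ k ∈ Finset.range (2 * w), if ∃ b ∈ O, e b + k = i + w then 1 else 0) =
      (O.image e).card := by
    intro i _
    rw [← Finset.card_filter]
    have hlt : ∀ c ∈ O.image e, c ≤ w := by
      intro c hc
      obtain ⟨b, -, rfl⟩ := Finset.mem_image.1 hc
      have := he b
      omega
    refine Finset.card_bij' (fun k _ => i + w - k) (fun c _ => i + w - c) ?_ ?_ ?_ ?_
    · intro k hk
      obtain ⟨-, b, hb, h⟩ := Finset.mem_filter.1 hk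
      exact Finset.mem_image.2 ⟨b, hb, by omega⟩
    · intro c hc
      have := hlt c hc
      obtain ⟨b, hb, rfl⟩ := Finset.mem_image.1 hc
      have hb' := he b
      have hi := i.isLt
      by_cases h0 : i + w - e b < 2 * w
      · exact Finset.mem_filter.2 ⟨Finset.mem_range.2 h0, b, hb, by omega⟩
      · omega
    · intro k hk
      obtain ⟨-, b, hb, h⟩ := Finset.mem_filter.1 hk
      omega
    · intro c hc
      have := hlt c hc
      omega
  rw [Finset.sum_congr rfl h2, Finset.sum_const, Finset.card_compl, Fintype.card_fin, smul_eq_mul]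

theorem card_newlyHit_le_image (O : Finset (Fin w)) (e : Fin w → ℕ) (k : ℕ) :
    (newlyHit O e k).card ≤ (O.image e).card := by
  refine Finset.card_le_card_of_injOn (fun i => i + w - k) ?_ ?_
  · intro i hi
    obtain ⟨-, b, hb, h⟩ := Finset.mem_filter.1 hi
    exact Finset.mem_coe.2 (Finset.mem_image.2 ⟨b, hb, (by omega : e b = i + w - k)⟩)
  · intro i hi j hj hij
    obtain ⟨-, b, hb, h⟩ := Finset.mem_filter.1 hi
    obtain ⟨-, b', hb', h'⟩ := Finset.mem_filter.1 hj
    simp only at hij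
    exact Fin.ext (by omega)

theorem card_newlyHit_add_le (O : Finset (Fin w)) (e : Fin w → ℕ) (k : ℕ) :
    O.card + (newlyHit O e k).card ≤ w := by
  have h := Finset.card_le_card (Finset.filter_subset (fun i : Fin w => ∃ b ∈ O, e b + k = i + w) Oᶜ)
  have h' := Finset.card_compl_add_card O
  rw [Fintype.card_fin] at h'
  rw [newlyHit]
  omega

/-- Only `c` and `c - 1` can be sent to `c`, so at most two anchors collide in one cell. -/
theorem card_le_two_mul_card_image (O : Finset (Fin w)) (e : Fin w → ℕ)
    (he : ∀ b, e b = b ∨ e b = b + 1) : O.card ≤ 2 * (O.image e).card := by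
  refine Finset.card_le_mul_card_image O 2 fun c _ => ?_
  have h : (O.filter fun b => e b = c).image (fun b : Fin w => (b : ℕ)) ⊆ {c, c - 1} := by
    intro x hx
    obtain ⟨b, hb, rfl⟩ := Finset.mem_image.1 hx
    have h1 := (Finset.mem_filter.1 hb).2
    have h2 := he b
    rw [Finset.mem_insert, Finset.mem_singleton]
    omega
  rw [← Finset.card_image_of_injective _ Fin.val_injective]
  exact (Finset.card_le_card h).trans Finset.card_le_two

/-- Reduces one iteration to the combinatorics of `newlyHit`. The map `e` depends on the offset `θ`
but neither on `k` nor on `r`, which permits summing over `k` afterwards. -/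
theorem Beam.card_occ_step_shift {B : ℝ} (hB : 0 < B) (hw : 0 < w) {A : Beam w}
    (hA : A.Consistent B) {θ : ℝ} (h0 : 0 ≤ θ) (h1 : θ < B / w) :
    ∃ e : Fin w → ℕ, (∀ b, e b = b ∨ e b = b + 1) ∧
      ∀ (k : ℕ) (r : Fin w → ℝ), (A.step B (-B + k * (B / w) + θ) r).occ.card =
        A.occ.card + (newlyHit A.occ e k).card := by
  classical
  have hw' : (0 : ℝ) < w := by exact_mod_cast hw
  have hex : ∀ b : Fin w, ∃ n : ℕ, (n = b ∨ n = b + 1) ∧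
      ∀ a, A b = some a → cell w B (a + θ) = n := by
    intro b
    cases hb : A b with
    -- The value at an empty bucket is never consulted by `newlyHit`; `b` merely keeps the required
    -- form.
    | none => exact ⟨b, by simp⟩
    | some a =>
      have hc := (mem_bucket_iff_cell hB b a).1 (hA b a hb)
      rcases cell_add_cases hB hw a h0 h1 with h | h
      · exact ⟨b, Or.inl rfl, fun a' ha' => by cases ha'; rw [h, hc]⟩
      · exact ⟨b + 1, Or.inr rfl, fun a' ha' => by cases ha'; rw [h, hc]; push_cast; rfl⟩
  choose e he hcell using hex
  refine ⟨e, he, fun k r => ?_⟩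
  have hdisj : Disjoint A.occ (newlyHit A.occ e k) :=
    Finset.disjoint_left.2 fun i hi hi' =>
      Finset.mem_compl.1 (Finset.mem_filter.1 hi').1 hi
  rw [← Finset.card_union_of_disjoint hdisj]
  congr 1
  ext i
  have key : ∀ b a, A b = some a →
      (a + (-B + k * (B / w) + θ) ∈ bucket w B i ↔ e b + k = i + w) := by
    intro b a hb
    have heq : a + (-B + k * (B / w) + θ) = a + θ + ((k - w : ℤ) : ℝ) * (B / w) := by
      push_cast
      field_simp
      ring
    rw [mem_bucket_iff_cell hB, heq, cell_add_mul hB hw, hcell b a hb]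
    omega
  rw [Beam.mem_occ_step hB hA, Finset.mem_union, newlyHit, Finset.mem_filter, Finset.mem_compl]
  by_cases hi : i ∈ A.occ
  · simp [hi]
  · simp only [hi, false_or, not_false_eq_true, true_and]
    constructor
    · rintro ⟨b, a, hb, h⟩
      exact ⟨b, Beam.mem_occ.2 ⟨a, hb⟩, (key b a hb).1 h⟩
    · rintro ⟨b, hb, h⟩
      obtain ⟨a, ha⟩ := Beam.mem_occ.1 hb
      exact ⟨b, a, ha, (key b a ha).2 h⟩

end Shift

/-! ### Measurability of the process -/

section Measurability

variable {α : Type*} [MeasurableSpace α]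

/-- Measurability of a partially defined real function. -/
def MeasurableOption (f : α → Option ℝ) : Prop :=
  ∀ U : Set ℝ, MeasurableSet U → MeasurableSet {x | ∃ a ∈ U, f x = some a}

/-- Measurability of a list-valued function, entry by entry. -/
def MeasurableList (l : α → List ℝ) : Prop := ∀ n : ℕ, MeasurableOption fun x => (l x)[n]?

/-- Measurability of a random state, bucket by bucket. -/
def MeasurableBeam {w : ℕ} (A : α → Beam w) : Prop := ∀ i, MeasurableOption fun x => A x i

theorem measurableOption_none : MeasurableOption fun _ : α => none := fun U _ => by simp

theorem MeasurableOption.ite {c : α → Prop} [DecidablePred c] (hc : MeasurableSet {x | c x})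
    {f g : α → Option ℝ} (hf : MeasurableOption f) (hg : MeasurableOption g) :
    MeasurableOption fun x => if c x then f x else g x := fun U hU => by
  have h : {x | ∃ a ∈ U, (if c x then f x else g x) = some a} =
      ({x | c x} ∩ {x | ∃ a ∈ U, f x = some a}) ∪ ({x | c x}ᶜ ∩ {x | ∃ a ∈ U, g x = some a}) := by
    ext x
    by_cases hx : c x <;> simp [hx]
  rw [h]
  exact (hc.inter (hf U hU)).union (hc.compl.inter (hg U hU))

theorem MeasurableOption.isSome {f : α → Option ℝ} (hf : MeasurableOption f) :
    MeasurableSet {x | (f x).isSome} := by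
  simpa [Option.isSome_iff_exists] using hf Set.univ MeasurableSet.univ

theorem MeasurableOption.filter_map {f : α → Option ℝ} (hf : MeasurableOption f) {g : α → ℝ}
    (hg : Measurable g) {U : Set ℝ} (hU : MeasurableSet U) [DecidablePred (· ∈ U)] :
    MeasurableOption fun x => ((f x).map (· + g x)).filter (· ∈ U) := fun T hT => by
  have hd : Measurable fun x => (f x).getD 0 := by
    intro S hS
    have h : (fun x => (f x).getD 0) ⁻¹' S =
        {x | ∃ a ∈ S, f x = some a} ∪ ({x | (f x).isSome}ᶜ ∩ {_x | (0 : ℝ) ∈ S}) := by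
      ext x
      cases hx : f x <;> simp [hx]
    rw [h]
    exact (hf S hS).union (hf.isSome.compl.inter (MeasurableSet.const _))
  have h : {x | ∃ a ∈ T, ((f x).map (· + g x)).filter (· ∈ U) = some a} =
      {x | (f x).isSome} ∩ (fun x => (f x).getD 0 + g x) ⁻¹' (T ∩ U) := by
    ext x
    cases hx : f x with
    | none => simp [hx]
    | some b =>
      simp only [hx, Set.mem_ofPred_eq, Set.mem_inter_iff, Set.mem_preimage, Option.map_some,
        Option.isSome_some, Option.getD_some, Option.filter_eq_some_iff, Option.some.injEq,
        decide_eq_true_eq, true_and]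
      constructor
      · rintro ⟨a, ha, rfl, hU⟩
        exact ⟨ha, hU⟩
      · rintro ⟨h1, h2⟩
        exact ⟨_, h1, rfl, h2⟩
  rw [h]
  exact hf.isSome.inter ((hd.add hg) (hT.inter hU))

theorem measurableList_nil : MeasurableList fun _ : α => [] := fun n => by
  simpa using measurableOption_none

theorem measurableBeam_const {w : ℕ} (A : Beam w) : MeasurableBeam fun _ : α => A :=
  fun i U _ => MeasurableSet.const (∃ a ∈ U, A i = some a)

/-- Positions in a filtered list depend on which earlier entries are present. The induction splits
on whether the head is present, and entry `n` of the whole then reduces to the head or to an entry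
of the tail. -/
theorem MeasurableList.filterMap_append {ι : Type*} (L : List ι) {f : α → ι → Option ℝ}
    (hf : ∀ i, MeasurableOption fun x => f x i) {l : α → List ℝ} (hl : MeasurableList l) :
    MeasurableList fun x => L.filterMap (f x) ++ l x := by
  induction L with
  | nil => simpa using hl
  | cons i L ih =>
    have h : ∀ x, (i :: L).filterMap (f x) ++ l x =
        if (f x i).isSome then (f x i).getD 0 :: (L.filterMap (f x) ++ l x)
        else L.filterMap (f x) ++ l x := fun x => by
      cases hx : f x i <;> simp [hx]
    intro n
    simp only [h]
    have h' : ∀ x, (if (f x i).isSome then (f x i).getD 0 :: (L.filterMap (f x) ++ l x)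
        else L.filterMap (f x) ++ l x)[n]? =
        if (f x i).isSome then ((f x i).getD 0 :: (L.filterMap (f x) ++ l x))[n]?
        else (L.filterMap (f x) ++ l x)[n]? := fun x => by split_ifs <;> rfl
    simp only [h']
    cases n with
    | zero =>
      have h2 : ∀ x, (if (f x i).isSome then ((f x i).getD 0 :: (L.filterMap (f x) ++ l x))[0]?
          else (L.filterMap (f x) ++ l x)[0]?) =
          if (f x i).isSome then f x i else (L.filterMap (f x) ++ l x)[0]? := fun x => by
        cases hx : f x i <;> simp
      simp only [h2]
      exact MeasurableOption.ite (hf i).isSome (hf i) (ih 0)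
    | succ n =>
      simp only [List.getElem?_cons_succ]
      exact MeasurableOption.ite (hf i).isSome (ih n) (ih (n + 1))

theorem MeasurableList.measurable_length {l : α → List ℝ} (hl : MeasurableList l) :
    Measurable fun x => (l x).length := by
  refine measurable_of_Ioi fun n => ?_
  have h : (fun x => (l x).length) ⁻¹' Set.Ioi n = {x | ((l x)[n]?).isSome} := by
    ext x
    simp
  rw [h]
  exact (hl n).isSome

theorem MeasurableList.pick {l : α → List ℝ} (hl : MeasurableList l) {r : α → ℝ}
    (hr : Measurable r) : MeasurableOption fun x => pick (r x) (l x) := fun U hU => by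
  have hk : Measurable fun x => min ⌊r x * ((l x).length : ℝ)⌋₊ ((l x).length - 1) := by
    have h := hl.measurable_length
    have hc : Measurable fun x => ((l x).length : ℝ) := measurable_from_nat.comp h
    have hp : Measurable fun x => (l x).length - 1 :=
      (measurable_from_nat (f := fun n : ℕ => n - 1)).comp h
    exact (Nat.measurable_floor.comp (hr.mul hc)).min hp
  have h : {x | ∃ a ∈ U, _root_.pick (r x) (l x) = some a} =
      ⋃ n : ℕ, (fun x => min ⌊r x * ((l x).length : ℝ)⌋₊ ((l x).length - 1)) ⁻¹' {n} ∩
        {x | ∃ a ∈ U, (l x)[n]? = some a} := by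
    ext x
    simp [_root_.pick]
  rw [h]
  exact MeasurableSet.iUnion fun n => (hk (measurableSet_singleton n)).inter (hl n U hU)

/-- Puts the candidates into the form of two `filterMap`s over a fixed index list, to which
`MeasurableList.filterMap_append` applies. Excluding the number is treated as a shift by 0. -/
theorem Beam.candidates_eq {w : ℕ} (B : ℝ) (A : Beam w) (s : ℝ) (i : Fin w)
    [DecidablePred (· ∈ bucket w B i)] :
    A.candidates B s i =
      (List.finRange w).filterMap (fun b => ((A b).map (· + 0)).filter (· ∈ bucket w B i)) ++
      (List.finRange w).filterMap (fun b => ((A b).map (· + s)).filter (· ∈ bucket w B i)) := by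
  have h : ∀ t : ℝ, ∀ L : List (Fin w),
      ((L.filterMap A).map (· + t)).filter (fun x => decide (x ∈ bucket w B i)) =
      L.filterMap (fun b => ((A b).map (· + t)).filter (· ∈ bucket w B i)) := by
    intro t L
    induction L with
    | nil => rfl
    | cons b L ih =>
      cases hb : A b with
      | none => simpa [hb] using ih
      | some a =>
        by_cases ha : a + t ∈ bucket w B i
        · simp [hb, ha, ih, Option.filter_some]
        · simpa [hb, ha, Option.filter_some] using ih
  rw [← h, ← h, candidates, expand, List.filter_append, toList]
  simp only [add_zero, List.map_id']
  congr!

theorem MeasurableBeam.candidates {w : ℕ} {B : ℝ} {A : α → Beam w} (hA : MeasurableBeam A)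
    {s : α → ℝ} (hs : Measurable s) (i : Fin w) :
    MeasurableList fun x => (A x).candidates B (s x) i := by
  classical
  simp only [Beam.candidates_eq]
  have hU : MeasurableSet (bucket w B i) := measurableSet_Ico
  refine MeasurableList.filterMap_append _
    (fun b => (hA b).filter_map measurable_const hU) ?_
  have h := MeasurableList.filterMap_append (List.finRange w)
    (fun b => (hA b).filter_map hs hU) measurableList_nil
  simpa using h

theorem MeasurableBeam.step {w : ℕ} {B : ℝ} {A : α → Beam w} (hA : MeasurableBeam A)
    {s : α → ℝ} (hs : Measurable s) {r : α → Fin w → ℝ} (hr : ∀ i, Measurable fun x => r x i) :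
    MeasurableBeam fun x => (A x).step B (s x) (r x) :=
  fun i => (hA.candidates hs i).pick (hr i)

theorem measurableBeam_phaseA {w : ℕ} {B : ℝ} {s r : ℕ → α → ℝ} (hs : ∀ k, Measurable (s k))
    (hr : ∀ k, Measurable (r k)) (n : ℕ) :
    MeasurableBeam fun x => phaseA w B (fun k => s k x) (fun k => r k x) n := by
  induction n with
  | zero => exact measurableBeam_const (fun i => phaseA w B (fun _ => 0) (fun _ => 0) 0 i)
  | succ n ih => exact ih.step (hs n) fun i => hr _

theorem MeasurableBeam.measurable_card_occ {w : ℕ} {A : α → Beam w} (hA : MeasurableBeam A) :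
    Measurable fun x => (A x).occ.card := by
  simp only [Beam.occ, Finset.card_filter]
  exact Finset.measurable_sum _ fun i _ =>
    Measurable.ite (hA i).isSome measurable_const measurable_const

end Measurability

/-! ### Potentials -/

/-- A potential of the number of occupied buckets which decreases in expectation by the factor
`1 - ρ` in every iteration. -/
structure IsPotential (w : ℕ) (ρ : ℝ) (V : ℕ → ℝ) : Prop where
  nonneg : ∀ N, 0 ≤ V N
  full : V w = 0
  decay : ∀ N K F : ℕ, 1 ≤ N → N < w → N ≤ 2 * K → K ≤ N → F ≤ K → N + F ≤ w →
    V (N + F) ≤ V N * (1 - 2 * w * ρ * F / (K * (w - N)))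

/-- The right side of `decay` is affine in `F`, so only the sum of `F` over the shifts matters. Its
value (w-N)K cancels the denominator K(w-N), and K drops out. -/
theorem IsPotential.sum_le {w : ℕ} {ρ : ℝ} {V : ℕ → ℝ} (hV : IsPotential w ρ V)
    {O : Finset (Fin w)} (hO : 1 ≤ O.card) {e : Fin w → ℕ} (he : ∀ b, e b = b ∨ e b = b + 1) :
    ∑ k ∈ Finset.range (2 * w), V (O.card + (newlyHit O e k).card) ≤
      2 * w * ((1 - ρ) * V O.card) := by
  have hle : O.card ≤ w := by simpa using O.card_le_univ
  rcases hle.lt_or_eq with hlt | heq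
  · set K := (O.image e).card with hK
    have hK2 := card_le_two_mul_card_image O e he
    have hKN : K ≤ O.card := Finset.card_image_le
    have hK0 : (0 : ℝ) < K := by exact_mod_cast (by omega : 0 < K)
    have hU0 : (0 : ℝ) < w - O.card := by
      have : (O.card : ℝ) < w := by exact_mod_cast hlt
      linarith
    have hsum : ∑ k ∈ Finset.range (2 * w), ((newlyHit O e k).card : ℝ) = (w - O.card) * K := by
      have := sum_card_newlyHit O e he
      rw [← Nat.cast_sub hle]
      exact_mod_cast this
    calc ∑ k ∈ Finset.range (2 * w), V (O.card + (newlyHit O e k).card)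
        ≤ ∑ k ∈ Finset.range (2 * w), (V O.card -
            V O.card * (2 * w * ρ / (K * (w - O.card))) * (newlyHit O e k).card) := by
          refine Finset.sum_le_sum fun k _ => ?_
          refine (hV.decay O.card K _ hO hlt hK2 hKN (card_newlyHit_le_image O e k)
            (card_newlyHit_add_le O e k)).trans_eq ?_
          ring
      _ = 2 * w * ((1 - ρ) * V O.card) := by
          rw [Finset.sum_sub_distrib, ← Finset.mul_sum, hsum, Finset.sum_const, Finset.card_range]
          field_simp
          ring
  -- A full state has no empty bucket left to hit, and its potential is 0.
  · have h0 : ∀ k, (newlyHit O e k).card = 0 := fun k => by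
      have := card_newlyHit_add_le O e k
      omega
    simp [h0, heq, hV.full]

/-! ### The expected potential -/

/-- Separates the cell index `k` of a number from its offset `θ`, so that the sum over `k` can be
estimated for each `θ`. -/
theorem setLIntegral_Ico_eq_sum (f : ℝ → ENNReal) (a : ℝ) {d : ℝ} (hd : 0 ≤ d) (n : ℕ) :
    ∫⁻ x in Set.Ico a (a + n * d), f x =
      ∑ k ∈ Finset.range n, ∫⁻ θ in Set.Ico 0 d, f (a + k * d + θ) := by
  induction n with
  | zero => simp
  | succ n ih =>
    have hnd : 0 ≤ n * d := by positivity
    have hu : Set.Ico a (a + (n + 1 : ℕ) * d) =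
        Set.Ico a (a + n * d) ∪ Set.Ico (a + n * d) (a + n * d + d) := by
      rw [Set.Ico_union_Ico_eq_Ico (by linarith) (by linarith)]
      congr 1
      push_cast
      ring
    have hdisj : Disjoint (Set.Ico a (a + n * d)) (Set.Ico (a + n * d) (a + n * d + d)) :=
      Set.Ico_disjoint_Ico_same
    rw [hu, lintegral_union measurableSet_Ico hdisj, ih, Finset.sum_range_succ]
    congr 1
    have hpre : (fun θ => a + n * d + θ) ⁻¹' Set.Ico (a + n * d) (a + n * d + d) =
        Set.Ico 0 d := by
      ext θ
      simp
    rw [← hpre, (measurePreserving_add_left volume (a + n * d)).setLIntegral_comp_preimage_emb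
      (measurableEmbedding_addLeft _)]

theorem IsPotential.lintegral_step_le {w : ℕ} {B ρ : ℝ} (hB : 0 < B) (hw : 0 < w) (hρ : ρ ≤ 1)
    {V : ℕ → ℝ} (hV : IsPotential w ρ V) {A : Beam w} (hA : A.Consistent B)
    (hne : 1 ≤ A.occ.card) (r : Fin w → ℝ) :
    ∫⁻ s in Set.Icc (-B) B, ENNReal.ofReal (V (A.step B s r).occ.card) ≤
      ENNReal.ofReal (2 * B * ((1 - ρ) * V A.occ.card)) := by
  have hw' : (0 : ℝ) < w := by exact_mod_cast hw
  have hd : 0 < B / w := by positivity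
  have hB2 : -B + ((2 * w : ℕ) : ℝ) * (B / w) = B := by
    push_cast
    field_simp
    ring
  have hmeas : Measurable fun s => ENNReal.ofReal (V (A.step B s r).occ.card) := by
    have h2 := ((measurableBeam_const A).step (B := B) (s := fun s => s) measurable_id (r := fun _ => r)
      fun i => measurable_const).measurable_card_occ
    exact ENNReal.measurable_ofReal.comp (measurable_from_nat.comp h2)
  have hsplit := setLIntegral_Ico_eq_sum
    (fun s => ENNReal.ofReal (V (A.step B s r).occ.card)) (-B) hd.le (2 * w)
  rw [hB2] at hsplit
  rw [setLIntegral_congr Ico_ae_eq_Icc.symm, hsplit, ← lintegral_finsetSum]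
  · calc ∫⁻ θ in Set.Ico 0 (B / w), ∑ k ∈ Finset.range (2 * w),
          ENNReal.ofReal (V (A.step B (-B + k * (B / w) + θ) r).occ.card)
        ≤ ∫⁻ _ in Set.Ico 0 (B / w), ENNReal.ofReal (2 * w * ((1 - ρ) * V A.occ.card)) := by
          refine setLIntegral_mono' measurableSet_Ico fun θ hθ => ?_
          obtain ⟨e, he, hcard⟩ := Beam.card_occ_step_shift hB hw hA hθ.1 hθ.2
          simp only [hcard]
          rw [← ENNReal.ofReal_sum_of_nonneg fun _ _ => hV.nonneg _]
          exact ENNReal.ofReal_le_ofReal (hV.sum_le hne he)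
      _ = ENNReal.ofReal (2 * B * ((1 - ρ) * V A.occ.card)) := by
          rw [setLIntegral_const, Real.volume_Ico, sub_zero, ← ENNReal.ofReal_mul]
          · congr 1
            field_simp
          · have := hV.nonneg A.occ.card
            have : 0 ≤ 1 - ρ := by linarith
            positivity
  · intro k _
    exact hmeas.comp (measurable_const.add measurable_id)

theorem IsPotential.lintegral_uniform_step_le {w : ℕ} {B ρ : ℝ} (hB : 0 < B) (hw : 0 < w)
    (hρ : ρ ≤ 1) {V : ℕ → ℝ} (hV : IsPotential w ρ V) {A : Beam w} (hA : A.Consistent B)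
    (hne : 1 ≤ A.occ.card) (r : Fin w → ℝ) {Q : Measure ℝ}
    (hQ : Q = cond volume (Set.Icc (-B) B)) :
    ∫⁻ s, ENNReal.ofReal (V (A.step B s r).occ.card) ∂Q ≤
      ENNReal.ofReal (1 - ρ) * ENNReal.ofReal (V A.occ.card) := by
  have h2B : 0 < B - -B := by linarith
  have h0 : 0 ≤ (B - -B)⁻¹ := by positivity
  rw [hQ, ProbabilityTheory.cond, lintegral_smul_measure, Real.volume_Icc, smul_eq_mul]
  refine (mul_le_mul_right (hV.lintegral_step_le hB hw hρ hA hne r) _).trans_eq ?_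
  rw [← ENNReal.ofReal_mul (by linarith), ← ENNReal.ofReal_inv_of_pos h2B,
    ← ENNReal.ofReal_mul h0]
  congr 1
  field_simp
  ring

theorem one_le_card_occ_phaseA {w : ℕ} {B : ℝ} (hB : 0 < B) (hw : 0 < w) (s r : ℕ → ℝ) (n : ℕ) :
    1 ≤ (phaseA w B s r n).occ.card := by
  induction n with
  | zero => exact (card_occ_phaseA_zero hB hw s r).ge
  | succ n ih =>
    refine ih.trans (Finset.card_le_card fun i hi => ?_)
    exact (Beam.mem_occ_step hB (phaseA_consistent w B s r n)).2 (Or.inl hi)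

/-- The state after `j` iterations is a measurable function of inputs which are independent of the
next number. -/
theorem IsPhaseAInput.exists_factor {Ω : Type u} [MeasurableSpace Ω] {P : Measure Ω} {B : ℝ}
    {s r : ℕ → Ω → ℝ} (w : ℕ) (h : IsPhaseAInput P B s r) (j : ℕ) :
    ∃ (S : Finset (ℕ ⊕ ℕ)) (X : Ω → S → ℝ) (s' r' : ℕ → (S → ℝ) → ℝ),
      Measurable X ∧ (∀ k, Measurable (s' k)) ∧ (∀ k, Measurable (r' k)) ∧
      IndepFun X (s j) P ∧
      ∀ ω, phaseA w B (fun k => s k ω) (fun k => r k ω) j =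
        phaseA w B (fun k => s' k (X ω)) (fun k => r' k (X ω)) j := by
  classical
  let S : Finset (ℕ ⊕ ℕ) := (Finset.range j).disjSum (Finset.range (j * w))
  let T : Finset (ℕ ⊕ ℕ) := {Sum.inl j}
  have hST : Disjoint S T := by simp [S, T]
  have hmeas : ∀ i, Measurable (Sum.elim s r i) := by
    rintro (k | k)
    exacts [h.measurable_s k, h.measurable_r k]
  refine ⟨S, fun ω i => Sum.elim s r i ω,
    fun k t => if hk : Sum.inl k ∈ S then t ⟨_, hk⟩ else 0,
    fun k t => if hk : Sum.inr k ∈ S then t ⟨_, hk⟩ else 0,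
    measurable_pi_lambda _ fun i => hmeas i, fun k => ?_, fun k => ?_, ?_, fun ω => ?_⟩
  · beta_reduce; split_ifs <;> fun_prop
  · beta_reduce; split_ifs <;> fun_prop
  · exact (h.indep.indepFun_finset S T hST hmeas).comp (φ := id)
      (ψ := fun t : T → ℝ => t ⟨Sum.inl j, by simp [T]⟩) measurable_id (measurable_pi_apply _)
  · refine phaseA_congr (fun k hk => ?_) (fun k hk => ?_)
    · have hk' : Sum.inl k ∈ S := by simpa [S] using hk
      simp [hk']
    · have hk' : Sum.inr k ∈ S := by simpa [S] using hk
      simp [hk']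

section Expectation

variable {Ω : Type u} [MeasurableSpace Ω] {P : Measure Ω} [IsProbabilityMeasure P]
  {w : ℕ} {B ρ : ℝ} {s r : ℕ → Ω → ℝ} {V : ℕ → ℝ}

theorem lintegral_comp_le_of_indepFun {T : Type*} [MeasurableSpace T] {X : Ω → T} {Y : Ω → ℝ}
    (hX : Measurable X) (hY : Measurable Y) (hind : IndepFun X Y P) {H : T × ℝ → ENNReal}
    (hH : Measurable H) {g : T → ENNReal} (hg : Measurable g) {c : ENNReal}
    (h : ∀ t, ∫⁻ y, H (t, y) ∂(P.map Y) ≤ c * g t) :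
    ∫⁻ ω, H (X ω, Y ω) ∂P ≤ c * ∫⁻ ω, g (X ω) ∂P := by
  have := Measure.isProbabilityMeasure_map (μ := P) hY.aemeasurable
  rw [← lintegral_map hH (hX.prodMk hY),
    (indepFun_iff_map_prod_eq_prod_map_map hX.aemeasurable hY.aemeasurable).1 hind,
    lintegral_prod _ hH.aemeasurable, ← lintegral_map hg hX, ← lintegral_const_mul _ hg]
  exact lintegral_mono h

/-- The past is independent of the next number, so conditioning on the past becomes an iterated
integral, and the one-step estimate holds for each fixed past. -/
theorem IsPotential.lintegral_phaseA_succ_le (hB : 0 < B) (hw : 0 < w) (hρ : ρ ≤ 1)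
    (hV : IsPotential w ρ V) (h : IsPhaseAInput P B s r) (j : ℕ) :
    ∫⁻ ω, ENNReal.ofReal (V (phaseA w B (fun k => s k ω) (fun k => r k ω) (j + 1)).occ.card) ∂P ≤
      ENNReal.ofReal (1 - ρ) * ∫⁻ ω, ENNReal.ofReal
        (V (phaseA w B (fun k => s k ω) (fun k => r k ω) j).occ.card) ∂P := by
  obtain ⟨S, X, s', r', hX, hs', hr', hind, hGX⟩ := h.exists_factor w j
  have hcons : ∀ t, (phaseA w B (fun k => s' k t) (fun k => r' k t) j).Consistent B :=
    fun t => phaseA_consistent _ _ _ _ _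
  have hone : ∀ t, 1 ≤ (phaseA w B (fun k => s' k t) (fun k => r' k t) j).occ.card :=
    fun t => one_le_card_occ_phaseA hB hw _ _ _
  have hG := measurableBeam_phaseA (w := w) (B := B) hs' hr' j
  simp only [phaseA, hGX]
  generalize hGdef : (fun t => phaseA w B (fun k => s' k t) (fun k => r' k t) j) = G at *
  have hGdef' : ∀ t, phaseA w B (fun k => s' k t) (fun k => r' k t) j = G t :=
    fun t => congrFun hGdef t
  simp only [hGdef'] at *
  -- The coins of this iteration do not affect occupancy and may be set to 0; only the past and `s
  -- j` remain.
  have hcard : ∀ ω, (Beam.step B (G (X ω)) (s j ω) (fun i => r (j * w + i) ω)).occ =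
      (Beam.step B (G (X ω)) (s j ω) (fun _ => 0)).occ := by
    intro ω
    ext i
    rw [Beam.mem_occ_step hB (hcons _), Beam.mem_occ_step hB (hcons _)]
  simp only [hcard]
  refine lintegral_comp_le_of_indepFun (P := P) (X := X) (Y := s j)
    (H := fun p => ENNReal.ofReal (V (Beam.step B (G p.1) p.2 (fun _ => 0)).occ.card))
    (g := fun t => ENNReal.ofReal (V (G t).occ.card)) hX (h.measurable_s j) hind ?_ ?_ ?_
  · have h1 : MeasurableBeam fun p : (S → ℝ) × ℝ => G p.1 := fun i U hU =>
      measurable_fst (hG i U hU)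
    have h2 := (h1.step (B := B) measurable_snd (r := fun _ _ => 0)
      fun i => measurable_const).measurable_card_occ
    exact ENNReal.measurable_ofReal.comp (measurable_from_nat.comp h2)
  · exact ENNReal.measurable_ofReal.comp (measurable_from_nat.comp hG.measurable_card_occ)
  · intro t
    exact hV.lintegral_uniform_step_le hB hw hρ (hcons t) (hone t) _ (h.uniform_s j)

/-- The probability that some bucket is empty after `j` iterations. -/
theorem IsPotential.prob_le (hB : 0 < B) (hw : 0 < w) (hρ : ρ ≤ 1)
    (hV : IsPotential w ρ V) (h : IsPhaseAInput P B s r) {c : ℝ} (hc : 0 < c)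
    (hVc : ∀ N, 1 ≤ N → N < w → c ≤ V N) (j : ℕ) :
    P.real {ω | (phaseA w B (fun k => s k ω) (fun k => r k ω) j).anchors.ncard < w} ≤
      (1 - ρ) ^ j * V 1 / c := by
  have hE : ∫⁻ ω, ENNReal.ofReal
      (V (phaseA w B (fun k => s k ω) (fun k => r k ω) j).occ.card) ∂P ≤
      ENNReal.ofReal ((1 - ρ) ^ j * V 1) := by
    induction j with
    | zero => simp [card_occ_phaseA_zero hB hw]
    | succ j ih =>
      refine (hV.lintegral_phaseA_succ_le hB hw hρ h j).trans ?_
      refine (mul_le_mul_right ih _).trans_eq ?_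
      rw [← ENNReal.ofReal_mul (by linarith)]
      congr 1
      ring
  have hmeas : Measurable fun ω => ENNReal.ofReal
      (V (phaseA w B (fun k => s k ω) (fun k => r k ω) j).occ.card) :=
    ENNReal.measurable_ofReal.comp (measurable_from_nat.comp
      (measurableBeam_phaseA h.measurable_s h.measurable_r j).measurable_card_occ)
  have hsub : {ω | (phaseA w B (fun k => s k ω) (fun k => r k ω) j).anchors.ncard < w} ⊆
      {ω | ENNReal.ofReal c ≤ ENNReal.ofReal
        (V (phaseA w B (fun k => s k ω) (fun k => r k ω) j).occ.card)} := by
    intro ω hω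
    rw [Set.mem_ofPred_eq, (phaseA_consistent w B _ _ j).ncard_anchors hB] at hω
    exact ENNReal.ofReal_le_ofReal (hVc _ (one_le_card_occ_phaseA hB hw _ _ j) hω)
  have hcne : ENNReal.ofReal c ≠ 0 := by simpa using hc
  have hM := (measure_mono (μ := P) hsub).trans
    (meas_ge_le_lintegral_div hmeas.aemeasurable hcne ENNReal.ofReal_ne_top)
  have h0 : 0 ≤ (1 - ρ) ^ j * V 1 := mul_nonneg (pow_nonneg (by linarith) _) (hV.nonneg 1)
  refine ENNReal.toReal_le_of_le_ofReal (by positivity) (hM.trans ?_)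
  rw [ENNReal.ofReal_div_of_pos hc]
  gcongr

end Expectation

/-! ### Candidates of a consistent state -/

theorem List.filterMap_eq_toList_of_unique {ι β : Type*} {f : ι → Option β} {i : ι} :
    ∀ {l : List ι}, l.Nodup → i ∈ l → (∀ b, b ≠ i → f b = none) → l.filterMap f = (f i).toList
  | [], _, h, _ => by simp at h
  | b :: l, hl, h, hf => by
    obtain ⟨hb, hl⟩ := List.nodup_cons.1 hl
    by_cases hbi : b = i
    · subst hbi
      have h0 : l.filterMap f = [] := by
        rw [List.filterMap_eq_nil_iff]
        exact fun c hc => hf c fun h => hb (h ▸ hc)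
      cases hfb : f b <;> simp [hfb, h0]
    · have hi : i ∈ l := (List.mem_cons.1 h).resolve_left (Ne.symm hbi)
      rw [List.filterMap_cons_none (hf b hbi), List.filterMap_eq_toList_of_unique hl hi hf]

theorem List.length_filterMap_le_card {ι β : Type*} [DecidableEq ι] {f : ι → Option β}
    {l : List ι} (hl : l.Nodup) (T : Finset ι) (h : ∀ b, (f b).isSome → b ∈ T) :
    (l.filterMap f).length ≤ T.card := by
  rw [List.length_filterMap_eq_countP, List.countP_eq_length_filter,
    ← List.toFinset_card_of_nodup (hl.filter _)]
  refine Finset.card_le_card fun b hb => h b ?_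
  simpa using (List.mem_filter.1 (List.mem_toFinset.1 hb)).2

namespace Beam

variable {w : ℕ} {B : ℝ}

open scoped Classical in
/-- The shift of the anchor of bucket `b` by `s`, if it exists and lies in bucket `i`. -/
noncomputable def shiftInto (B : ℝ) (A : Beam w) (s : ℝ) (i b : Fin w) : Option ℝ :=
  ((A b).map (· + s)).filter (· ∈ bucket w B i)

theorem shiftInto_eq_some {A : Beam w} {s : ℝ} {i b : Fin w} {x : ℝ} :
    A.shiftInto B s i b = some x ↔ ∃ a, A b = some a ∧ x = a + s ∧ x ∈ bucket w B i := by
  simp only [shiftInto, Option.filter_eq_some_iff, Option.map_eq_some_iff, decide_eq_true_eq]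
  constructor
  · rintro ⟨⟨a, ha, rfl⟩, h⟩
    exact ⟨a, ha, rfl, h⟩
  · rintro ⟨a, ha, rfl, h⟩
    exact ⟨⟨a, ha, rfl⟩, h⟩

/-- The candidates for bucket `i` after the anchors of the first `k` buckets have been shifted. -/
noncomputable def partialCandidates (B : ℝ) (A : Beam w) (s : ℝ) (k : ℕ) (i : Fin w) : List ℝ :=
  (A i).toList ++ ((List.finRange w).take k).filterMap (A.shiftInto B s i)

theorem partialCandidates_zero (A : Beam w) (s : ℝ) (i : Fin w) :
    A.partialCandidates B s 0 i = (A i).toList := by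
  simp [partialCandidates]

theorem partialCandidates_succ (A : Beam w) (s : ℝ) (k : Fin w) (i : Fin w) :
    A.partialCandidates B s (k + 1) i =
      A.partialCandidates B s k i ++ (A.shiftInto B s i k).toList := by
  rw [partialCandidates, List.take_add_one, List.filterMap_append, ← List.append_assoc,
    ← partialCandidates]
  congr 1
  cases h : A.shiftInto B s i k <;> simp [h]

/-- Equality as lists is needed, since `pick` selects by position and the machine must store the
candidates in the same order. By consistency, only bucket `i` itself contributes an unshifted
candidate. -/
theorem Consistent.partialCandidates_eq {A : Beam w} (hB : 0 < B) (hA : A.Consistent B) (s : ℝ)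
    (i : Fin w) : A.partialCandidates B s w i = A.candidates B s i := by
  classical
  rw [candidates_eq, partialCandidates, List.take_of_length_le (by simp)]
  congr 1
  · rw [List.filterMap_eq_toList_of_unique (i := i) (List.nodup_finRange w)
      (List.mem_finRange i)]
    · cases h : A i with
      | none => simp
      | some a => simp [Option.filter_some, hA i a h]
    · intro b hb
      cases h : A b with
      | none => simp
      | some a =>
        have : a ∉ bucket w B i := fun ha => hb (hA.index_eq hB h ha)
        simp [Option.filter_some, this]

/-- One old anchor, plus at most two shifted ones: the preimage of a bucket under the shift is an
interval of one bucket width, which meets at most two cells. This keeps the writes of the machine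
within the record of a bucket. -/
theorem Consistent.length_partialCandidates_le {A : Beam w} (hB : 0 < B) (hA : A.Consistent B)
    (s : ℝ) (k : ℕ) (i : Fin w) : (A.partialCandidates B s k i).length ≤ 3 := by
  classical
  have hw : 0 < w := i.pos
  have hw' : (0 : ℝ) < w := by exact_mod_cast hw
  have hd : 0 < B / w := by positivity
  have h1 : (A i).toList.length ≤ 1 := by cases A i <;> simp
  have h2 : (((List.finRange w).take k).filterMap (A.shiftInto B s i)).length ≤ 2 := by
    -- the anchors that are shifted into bucket `i` lie in two consecutive cells
    set c : ℤ := cell w B (-B / 2 + i * (B / w) - s) with hc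
    set T : Finset (Fin w) := Finset.univ.filter fun b => ((b : ℕ) : ℤ) = c ∨ ((b : ℕ) : ℤ) = c + 1
    have hT : T.card ≤ 2 := by
      rw [← Finset.card_image_of_injective T
        (f := fun b : Fin w => ((b : ℕ) : ℤ)) fun a b h => Fin.ext (by simpa using h)]
      refine (Finset.card_le_card (t := {c, c + 1}) ?_).trans Finset.card_le_two
      intro x hx
      obtain ⟨b, hb, rfl⟩ := Finset.mem_image.1 hx
      simpa using (Finset.mem_filter.1 hb).2
    refine (List.length_filterMap_le_card
      ((List.nodup_finRange w).sublist (List.take_sublist _ _)) T fun b hb => ?_).trans hT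
    obtain ⟨x, hx⟩ := Option.isSome_iff_exists.1 hb
    obtain ⟨a, ha, rfl, h⟩ := shiftInto_eq_some.1 hx
    have hb := (mem_bucket_iff_cell hB b a).1 (hA b a ha)
    have h3 := h.1
    have h4 := h.2
    rcases cell_add_cases hB hw (-B / 2 + i * (B / w) - s)
      (θ := a - (-B / 2 + i * (B / w) - s)) (by linarith) (by linarith) with h5 | h5
    · rw [add_sub_cancel, hb] at h5
      exact Finset.mem_filter.2 ⟨Finset.mem_univ _, Or.inl h5⟩
    · rw [add_sub_cancel, hb] at h5
      exact Finset.mem_filter.2 ⟨Finset.mem_univ _, Or.inr h5⟩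
  rw [partialCandidates, List.length_append]
  omega

end Beam

/-! ### Execution of programs -/

namespace Prog

/-- The result and the final machine state of a program. -/
def exec {α : Type} (p : Prog α) (m : RAM) : α × RAM := (StateT.run p m : Id (α × RAM))

theorem exec_bind {α β : Type} (p : Prog α) (f : α → Prog β) (m : RAM) :
    exec (p >>= f) m = exec (f (exec p m).1) (exec p m).2 := rfl

theorem exec_pure {α : Type} (a : α) (m : RAM) : exec (pure a : Prog α) m = (a, m) := rfl

theorem exec_op {α : Type} (a : α) (m : RAM) :
    exec (op a) m = (a, { m with time := m.time + 1 }) := rfl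

theorem exec_load (a : ℕ) (m : RAM) : exec (load a) m =
    (m.mem a, { m with time := m.time + 1, space := max m.space (a + 1) }) := rfl

theorem exec_store (a : ℕ) (x : ℝ) (m : RAM) : exec (store a x) m =
    ((), { m with
      mem := Function.update m.mem a x, time := m.time + 1, space := max m.space (a + 1) }) := rfl

theorem exec_readItem (m : RAM) : exec readItem m =
    (m.items m.itemPos, { m with time := m.time + 1, itemPos := m.itemPos + 1 }) := rfl

theorem exec_readCoin (m : RAM) : exec readCoin m =
    (m.coins m.coinPos, { m with time := m.time + 1, coinPos := m.coinPos + 1 }) := rfl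

/-- The loop-invariant rule. The body starts from a state whose clock has already been charged for
the iteration. -/
theorem exec_forLoop_induct {body : ℕ → Prog Unit} {n : ℕ} {m : RAM} (I : ℕ → RAM → Prop)
    (h0 : I 0 m)
    (hs : ∀ k < n, ∀ m, I k m → I (k + 1) (exec (body k) { m with time := m.time + 1 }).2) :
    I n (exec (forLoop n body) m).2 := by
  induction n with
  | zero => exact h0
  | succ n ih =>
    exact hs n n.lt_succ_self _ (ih fun k hk => hs k (hk.trans n.lt_succ_self))

end Prog

namespace RAM

/-- The time and space used so far, and the positions of the input streams. -/
structure Resources (w : ℕ) (s r : ℕ → ℝ) (t i c : ℕ) (m : RAM) : Prop where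
  time : m.time ≤ t
  space : m.space ≤ 6 * w
  items : m.items = s
  coins : m.coins = r
  itemPos : m.itemPos = i
  coinPos : m.coinPos = c

/-- The memory holds the anchor `o` of bucket `i`. -/
def HoldsAnchor (m : RAM) (i : ℕ) (o : Option ℝ) : Prop :=
  (o = none → m.mem (6 * i) = 0) ∧ ∀ a, o = some a → m.mem (6 * i) = 1 ∧ m.mem (6 * i + 1) = a

/-- The memory holds the list `l` of candidates of bucket `i`. -/
def HoldsList (m : RAM) (i : ℕ) (l : List ℝ) : Prop :=
  m.mem (6 * i + 2) = l.length ∧ ∀ k x, l[k]? = some x → m.mem (6 * i + 3 + k) = x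

end RAM

/-! ### Specifications of the subroutines -/

namespace Prog

variable {w : ℕ} {B : ℝ} {s r : ℕ → ℝ}

open RAM

theorem setup_spec (hB : 0 < B) (hw : 0 < w) {t ip cp : ℕ} {m : RAM}
    (hm : m.Resources w s r t ip cp) :
    ∃ m', m' = (exec (setup w (B / 2) (B / w)) m).2 ∧
      m'.Resources w s r (t + 2 * w + 4) ip cp ∧
      ∀ i : Fin w, m'.HoldsAnchor i (phaseA w B s r 0 i) := by
  refine ⟨_, rfl, ?_⟩
  obtain ⟨i₀, hi₀⟩ := exists_mem_bucket hB hw (zero_mem_Ico_half hB)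
  have hfl : ⌊B / 2 / (B / w)⌋₊ = i₀ := by
    have h := (mem_bucket_iff_cell hB _ _).1 hi₀
    rw [cell, zero_add] at h
    rw [← Int.floor_toNat, h, Int.toNat_natCast]
  have hloop := exec_forLoop_induct (body := fun i => store (6 * i) 0) (n := w) (m := m)
    (fun k m => m.Resources w s r (t + 2 * k) ip cp ∧ ∀ i < k, m.mem (6 * i) = 0)
    ⟨hm, by simp⟩ (by
      rintro k hk m ⟨hm, h0⟩
      rw [exec_store]
      refine ⟨⟨by have := hm.time; dsimp; omega, by have := hm.space; dsimp; omega, hm.items,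
        hm.coins, hm.itemPos, hm.coinPos⟩, fun i hi => ?_⟩
      by_cases hik : i = k
      · simp [hik]
      · have h1 : 6 * i ≠ 6 * k := by omega
        simp only [Function.update_of_ne h1]
        exact h0 i (by omega))
  simp only [setup, exec_bind, div, floor, exec_op, exec_store]
  rw [hfl]
  set m' := (exec (forLoop w fun i => store (6 * i) 0) m).2
  obtain ⟨hm', h0⟩ := hloop
  have hi := i₀.isLt
  refine ⟨⟨?_, ?_, hm'.items, hm'.coins, hm'.itemPos, hm'.coinPos⟩, fun i => ?_⟩
  · have := hm'.time
    dsimp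
    omega
  · have := hm'.space
    dsimp
    omega
  · by_cases hii : i = i₀
    · subst hii
      simp [HoldsAnchor, phaseA, hi₀]
    · have h1 : (0 : ℝ) ∉ bucket w B i := fun h => hii <| Fin.ext <| by
        have h2 := (mem_bucket_iff_cell hB _ _).1 h
        rw [(mem_bucket_iff_cell hB _ _).1 hi₀] at h2
        exact_mod_cast h2.symm
      have hne : (i : ℕ) ≠ i₀ := fun h => hii (Fin.ext h)
      have h2 : 6 * (i : ℕ) ≠ 6 * (i₀ : ℕ) + 1 := by omega
      have h3 : 6 * (i : ℕ) ≠ 6 * (i₀ : ℕ) := by omega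
      simp [HoldsAnchor, phaseA, h1, h2, h3, h0 i i.isLt]

theorem keepOld_spec {A : Beam w} {t ip cp : ℕ} {m : RAM}
    (hm : m.Resources w s r t ip cp) (hA : ∀ i : Fin w, m.HoldsAnchor i (A i)) :
    ∃ m', m' = (exec (keepOld w) m).2 ∧ m'.Resources w s r (t + 6 * w) ip cp ∧
      (∀ i : Fin w, m'.HoldsAnchor i (A i)) ∧ ∀ i : Fin w, m'.HoldsList i (A i).toList := by
  refine ⟨_, rfl, ?_⟩
  have hloop := exec_forLoop_induct (n := w) (m := m) (body := fun i => do
      let f ← load (6 * i)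
      if ← lt 0 f then
        let a ← load (6 * i + 1)
        store (6 * i + 3) a
        store (6 * i + 2) 1
      else
        store (6 * i + 2) 0)
    (fun k m => m.Resources w s r (t + 6 * k) ip cp ∧ (∀ i : Fin w, m.HoldsAnchor i (A i)) ∧
      ∀ i : Fin w, (i : ℕ) < k → m.HoldsList i (A i).toList)
    ⟨hm, hA, by simp⟩ (by
      rintro k hk m ⟨hm, hA, hL⟩
      have ht := hm.time
      have hsp := hm.space
      have hAk := hA ⟨k, hk⟩
      cases ho : A ⟨k, hk⟩ with
      | none =>
        have hf : m.mem (6 * k) = 0 := hAk.1 ho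
        simp only [exec_bind, exec_load, lt, exec_op, hf, lt_irrefl, decide_false,
          Bool.false_eq_true, if_false, exec_store]
        refine ⟨⟨by dsimp; omega, by dsimp; omega, hm.items, hm.coins, hm.itemPos, hm.coinPos⟩,
          fun i => ?_, fun i hi => ?_⟩
        · have h1 : 6 * (i : ℕ) ≠ 6 * k + 2 := by omega
          have h2 : 6 * (i : ℕ) + 1 ≠ 6 * k + 2 := by omega
          simp only [HoldsAnchor, Function.update_of_ne h1, Function.update_of_ne h2]
          exact hA i
        · by_cases hik : (i : ℕ) = k
          · have : i = ⟨k, hk⟩ := Fin.ext hik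
            subst this
            simp [HoldsList, ho]
          · have h1 : ∀ j, 6 * (i : ℕ) + 3 + j ≠ 6 * k + 2 ∨ 3 ≤ j := by omega
            have h2 : 6 * (i : ℕ) + 2 ≠ 6 * k + 2 := by omega
            obtain ⟨h3, h4⟩ := hL i (by omega)
            refine ⟨by simpa only [Function.update_of_ne h2] using h3, fun j x hj => ?_⟩
            have hlen : (A i).toList.length ≤ 1 := by cases A i <;> simp
            have hj' := (List.getElem?_eq_some_iff.1 hj).1
            have h5 := (h1 j).resolve_right (by omega)
            simpa only [Function.update_of_ne h5] using h4 j x hj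
      | some a =>
        obtain ⟨hf, ha⟩ := hAk.2 a ho
        simp only [exec_bind, exec_load, lt, exec_op, hf, zero_lt_one, decide_true, if_true,
          exec_store]
        simp only at ha
        rw [ha]
        refine ⟨⟨by dsimp; omega, by dsimp; omega, hm.items, hm.coins, hm.itemPos, hm.coinPos⟩,
          fun i => ?_, fun i hi => ?_⟩
        · have h1 : 6 * (i : ℕ) ≠ 6 * k + 2 := by omega
          have h2 : 6 * (i : ℕ) + 1 ≠ 6 * k + 2 := by omega
          have h3 : 6 * (i : ℕ) ≠ 6 * k + 3 := by omega
          have h4 : 6 * (i : ℕ) + 1 ≠ 6 * k + 3 := by omega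
          simp only [HoldsAnchor, Function.update_of_ne h1, Function.update_of_ne h2,
            Function.update_of_ne h3, Function.update_of_ne h4]
          exact hA i
        · by_cases hik : (i : ℕ) = k
          · have : i = ⟨k, hk⟩ := Fin.ext hik
            subst this
            refine ⟨by simp [ho], fun j x hj => ?_⟩
            rw [ho] at hj
            have hj' : j = 0 := by
              have := (List.getElem?_eq_some_iff.1 hj).1
              simpa using this
            subst hj'
            simpa using hj
          · have h2 : 6 * (i : ℕ) + 2 ≠ 6 * k + 2 := by omega
            have h2' : 6 * (i : ℕ) + 2 ≠ 6 * k + 3 := by omega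
            obtain ⟨h3, h4⟩ := hL i (by omega)
            refine ⟨by simpa only [Function.update_of_ne h2, Function.update_of_ne h2'] using h3, fun j x hj => ?_⟩
            have hlen : (A i).toList.length ≤ 1 := by cases A i <;> simp
            have hj' := (List.getElem?_eq_some_iff.1 hj).1
            have h5 : 6 * (i : ℕ) + 3 + j ≠ 6 * k + 2 := by omega
            have h6 : 6 * (i : ℕ) + 3 + j ≠ 6 * k + 3 := by omega
            simpa only [Function.update_of_ne h5, Function.update_of_ne h6] using h4 j x hj)
  exact ⟨hloop.1, hloop.2.1, fun i => hloop.2.2 i i.isLt⟩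

theorem exec_place_of_notMem {h Δ x : ℝ} (hx : x ∉ Set.Ico (-h) h) (m : RAM) :
    ∃ t ≤ 3, (exec (place h Δ x) m).2 = { m with time := m.time + t } := by
  simp only [place, exec_bind, neg, le, lt, exec_op]
  by_cases h1 : -h ≤ x
  · have h2 : ¬ x < h := fun h2 => hx ⟨h1, h2⟩
    exact ⟨3, le_rfl, by simp [h1, h2, exec_bind, exec_op, exec_pure]⟩
  · exact ⟨2, by norm_num, by simp [h1, exec_pure]⟩

theorem exec_place_of_mem (hB : 0 < B) {x : ℝ} {i : Fin w} (hx : x ∈ bucket w B i) {m : RAM}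
    {c : ℕ} (hc : m.mem (6 * i + 2) = c) (hc2 : c ≤ 2) :
    (exec (place (B / 2) (B / w) x) m).2 = { m with
      mem := Function.update (Function.update m.mem (6 * i + 3 + c) x) (6 * i + 2) (c + 1)
      time := m.time + 11
      space := max (max m.space (6 * i + 3)) (6 * i + 4 + c) } := by
  have hcell := (mem_bucket_iff_cell hB i x).1 hx
  have hfl : ⌊(x + B / 2) / (B / w)⌋₊ = i := by
    rw [← Int.floor_toNat]
    rw [cell] at hcell
    rw [hcell, Int.toNat_natCast]
  obtain ⟨h1, h2⟩ := (mem_Ico_iff_cell hB i.pos x).2 (by rw [hcell]; have := i.isLt; omega)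
  simp only [place, exec_bind, neg, le, lt, add, div, floor, exec_op, exec_load, exec_store, h1,
    h2, decide_true, if_true, hfl, hc, Nat.floor_natCast]
  congr 1
  omega

theorem placeShifted_spec (hB : 0 < B) {A : Beam w} (hcons : A.Consistent B) {t ip cp : ℕ}
    {m : RAM} (x : ℝ) (hm : m.Resources w s r t ip cp)
    (hA : ∀ i : Fin w, m.HoldsAnchor i (A i)) (hL : ∀ i : Fin w, m.HoldsList i (A i).toList) :
    ∃ m', m' = (exec (placeShifted w (B / 2) (B / w) x) m).2 ∧
      m'.Resources w s r (t + 16 * w) ip cp ∧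
      (∀ i : Fin w, m'.HoldsAnchor i (A i)) ∧
      ∀ i : Fin w, m'.HoldsList i (A.candidates B x i) := by
  refine ⟨_, rfl, ?_⟩
  have hloop := exec_forLoop_induct (n := w) (m := m) (body := fun i => do
      let f ← load (6 * i)
      if ← lt 0 f then
        let a ← load (6 * i + 1)
        let x ← add a x
        place (B / 2) (B / w) x)
    (fun k m => m.Resources w s r (t + 16 * k) ip cp ∧ (∀ i : Fin w, m.HoldsAnchor i (A i)) ∧
      ∀ i : Fin w, m.HoldsList i (A.partialCandidates B x k i))
    ⟨hm, hA, by simpa only [Beam.partialCandidates_zero] using hL⟩ (by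
      rintro k hk m ⟨hm, hA, hL⟩
      have ht := hm.time
      have hsp := hm.space
      have hAk := hA ⟨k, hk⟩
      have hsucc := Beam.partialCandidates_succ (B := B) A x ⟨k, hk⟩
      simp only at hsucc
      cases ho : A ⟨k, hk⟩ with
      | none =>
        have hf : m.mem (6 * k) = 0 := hAk.1 ho
        simp only [exec_bind, exec_load, lt, exec_op, hf, lt_irrefl, decide_false,
          Bool.false_eq_true, if_false, exec_pure]
        refine ⟨⟨by dsimp; omega, by dsimp; omega, hm.items, hm.coins, hm.itemPos, hm.coinPos⟩,
          hA, fun i => ?_⟩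
        have hnone : A.shiftInto B x i ⟨k, hk⟩ = none := by simp [Beam.shiftInto, ho]
        rw [hsucc, hnone, Option.toList_none, List.append_nil]
        exact hL i
      | some a =>
        obtain ⟨hf, ha⟩ := hAk.2 a ho
        simp only at ha
        simp only [exec_bind, exec_load, lt, add, exec_op, hf, zero_lt_one, decide_true, if_true,
          ha]
        by_cases hmem : a + x ∈ Set.Ico (-(B / 2)) (B / 2)
        · obtain ⟨i₀, hi₀⟩ := exists_mem_bucket (w := w) hB (by omega) hmem
          have hsome : A.shiftInto B x i₀ ⟨k, hk⟩ = some (a + x) :=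
            Beam.shiftInto_eq_some.2 ⟨a, ho, rfl, hi₀⟩
          -- The list after appending `a + x` still has length at most three, so there is a free
          -- slot before the append.
          have hlen : (A.partialCandidates B x k i₀).length ≤ 2 := by
            have := hcons.length_partialCandidates_le hB x (k + 1) i₀
            rw [hsucc, hsome] at this
            simp only [Option.toList_some, List.length_append, List.length_singleton] at this
            omega
          set l := A.partialCandidates B x k i₀ with hl
          have hi := i₀.isLt
          rw [exec_place_of_mem hB hi₀ (c := l.length) (m := { m with
            time := m.time + 1 + 1 + 1 + 1 + 1
            space := max (max m.space (6 * k + 1)) (6 * k + 1 + 1) }) (hL i₀).1 hlen]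
          refine ⟨⟨by dsimp; omega, by dsimp; omega, hm.items, hm.coins, hm.itemPos,
            hm.coinPos⟩, fun i => ?_, fun i => ?_⟩
          · have h1 : 6 * (i : ℕ) ≠ 6 * i₀ + 2 := by omega
            have h2 : 6 * (i : ℕ) + 1 ≠ 6 * i₀ + 2 := by omega
            have h3 : 6 * (i : ℕ) ≠ 6 * i₀ + 3 + l.length := by omega
            have h4 : 6 * (i : ℕ) + 1 ≠ 6 * i₀ + 3 + l.length := by omega
            simp only [HoldsAnchor, Function.update_of_ne h1, Function.update_of_ne h2,
            Function.update_of_ne h3, Function.update_of_ne h4]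
            exact hA i
          · by_cases hii : i = i₀
            · subst hii
              rw [hsucc, hsome, ← hl]
              refine ⟨by simp, fun j y hj => ?_⟩
              have hj' := (List.getElem?_eq_some_iff.1 hj).1
              have h1 : 6 * (i : ℕ) + 3 + j ≠ 6 * i + 2 := by omega
              simp only [Function.update_of_ne h1]
              by_cases hjl : j = l.length
              · subst hjl
                simpa using hj
              · have h2 : 6 * (i : ℕ) + 3 + j ≠ 6 * i + 3 + l.length := by omega
                simp only [Function.update_of_ne h2]
                simp only [Option.toList_some, List.length_append, List.length_singleton] at hj'
                rw [List.getElem?_append_left (by omega)] at hj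
                exact (hL i).2 j y hj
            · have hnone : A.shiftInto B x i ⟨k, hk⟩ = none := by
                rw [Option.eq_none_iff_forall_ne_some]
                intro y hy
                obtain ⟨a', ha', rfl, h'⟩ := Beam.shiftInto_eq_some.1 hy
                rw [ho] at ha'
                cases ha'
                rw [mem_bucket_iff_cell hB] at h' hi₀
                exact hii (Fin.ext (by rw [h'] at hi₀; exact_mod_cast hi₀))
              have hne : (i : ℕ) ≠ i₀ := fun h => hii (Fin.ext h)
              have hlen' := hcons.length_partialCandidates_le hB x k i
              rw [hsucc, hnone, Option.toList_none, List.append_nil]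
              have h1 : 6 * (i : ℕ) + 2 ≠ 6 * i₀ + 2 := by omega
              have h2 : 6 * (i : ℕ) + 2 ≠ 6 * i₀ + 3 + l.length := by omega
              refine ⟨by simpa only [Function.update_of_ne h1, Function.update_of_ne h2] using (hL i).1, fun j y hj => ?_⟩
              have hj' := (List.getElem?_eq_some_iff.1 hj).1
              have h3 : 6 * (i : ℕ) + 3 + j ≠ 6 * i₀ + 2 := by omega
              have h4 : 6 * (i : ℕ) + 3 + j ≠ 6 * i₀ + 3 + l.length := by omega
              simpa only [Function.update_of_ne h3, Function.update_of_ne h4] using (hL i).2 j y hj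
        · obtain ⟨t', ht', he⟩ := exec_place_of_notMem (Δ := B / w) hmem
            { m with
              time := m.time + 1 + 1 + 1 + 1 + 1
              space := max (max m.space (6 * k + 1)) (6 * k + 1 + 1) }
          rw [he]
          refine ⟨⟨by dsimp; omega, by dsimp; omega, hm.items, hm.coins, hm.itemPos,
            hm.coinPos⟩, hA, fun i => ?_⟩
          have hnone : A.shiftInto B x i ⟨k, hk⟩ = none := by
            rw [Option.eq_none_iff_forall_ne_some]
            intro y hy
            obtain ⟨a', ha', rfl, h'⟩ := Beam.shiftInto_eq_some.1 hy
            rw [ho] at ha'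
            cases ha'
            rw [mem_bucket_iff_cell hB] at h'
            exact hmem ((mem_Ico_iff_cell hB i.pos _).2 (by rw [h']; have := i.isLt; omega))
          rw [hsucc, hnone, Option.toList_none, List.append_nil]
          exact hL i)
  refine ⟨hloop.1, hloop.2.1, fun i => ?_⟩
  rw [← hcons.partialCandidates_eq hB]
  exact hloop.2.2 i

/-- One coin is read for every bucket, even an empty one. Hence bucket `i` receives coin `cp + i`,
which matches the indexing in `phaseA`. -/
theorem trim_spec (hB : 0 < B) {A : Beam w} (hcons : A.Consistent B) {t ip cp : ℕ}
    {m : RAM} (x : ℝ) (hm : m.Resources w s r t ip cp)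
    (hA : ∀ i : Fin w, m.HoldsAnchor i (A i))
    (hL : ∀ i : Fin w, m.HoldsList i (A.candidates B x i)) :
    ∃ m', m' = (exec (trim w) m).2 ∧ m'.Resources w s r (t + 12 * w) ip (cp + w) ∧
      ∀ i : Fin w, m'.HoldsAnchor i (A.step B x (fun i => r (cp + i)) i) := by
  refine ⟨_, rfl, ?_⟩
  set A' := A.step B x (fun i => r (cp + i)) with hA'
  have hlen : ∀ i, (A.candidates B x i).length ≤ 3 := fun i => by
    rw [← hcons.partialCandidates_eq hB]
    exact hcons.length_partialCandidates_le hB x w i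
  have hloop := exec_forLoop_induct (n := w) (m := m) (body := fun i => do
      let r ← readCoin
      let c ← load (6 * i + 2)
      if ← lt 0 c then
        let y ← mul r c
        let k ← floor y
        let n ← floor c
        let n' ← predNat n
        let k' ← minNat k n'
        let a ← load (6 * i + 3 + k')
        store (6 * i + 1) a
        store (6 * i) 1)
    (fun k m => m.Resources w s r (t + 12 * k) ip (cp + k) ∧
      (∀ i : Fin w, m.HoldsAnchor i (if (i : ℕ) < k then A' i else A i)) ∧
      ∀ i : Fin w, m.HoldsList i (A.candidates B x i))
    ⟨hm, by simpa using hA, hL⟩ (by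
      rintro k hk m ⟨hm, hA, hL⟩
      have ht := hm.time
      have hsp := hm.space
      have hlen' := hlen ⟨k, hk⟩
      obtain ⟨hL1, hL2⟩ := hL ⟨k, hk⟩
      simp only at hL1 hL2
      have hAk := hA ⟨k, hk⟩
      simp only [lt_irrefl, if_false] at hAk
      by_cases hnil : A.candidates B x ⟨k, hk⟩ = []
      · have hA'k : A' ⟨k, hk⟩ = none := by
          rw [hA', Beam.step, hnil, pick_nil]
        -- The program does not clear flags. This is sound because an old anchor is a candidate for
        -- its own bucket: without candidates there was no anchor, and the flag is already 0.
        have hAnone : A ⟨k, hk⟩ = none := by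
          rw [Option.eq_none_iff_forall_ne_some]
          intro a ha
          have : a ∈ A.candidates B x ⟨k, hk⟩ :=
            Beam.mem_candidates.2 ⟨⟨_, a, ha, Or.inl rfl⟩, hcons _ a ha⟩
          simp [hnil] at this
        rw [hnil, List.length_nil, Nat.cast_zero] at hL1
        simp only [exec_bind, exec_readCoin, exec_load, lt, exec_op, hL1, lt_irrefl, decide_false,
          Bool.false_eq_true, if_false, exec_pure]
        refine ⟨⟨by dsimp; omega, by dsimp; omega, hm.items, hm.coins, hm.itemPos,
          by have := hm.coinPos; dsimp; omega⟩, fun i => ?_, hL⟩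
        by_cases hik : (i : ℕ) = k
        · have : i = ⟨k, hk⟩ := Fin.ext hik
          subst this
          rw [if_pos (by simp), hA'k, ← hAnone]
          exact hAk
        · have : (i : ℕ) < k + 1 ↔ (i : ℕ) < k := by omega
          simp only [this]
          exact hA i
      · set l := A.candidates B x ⟨k, hk⟩ with hl
        have hpos : 0 < l.length := List.length_pos_iff.2 hnil
        have hposR : (0 : ℝ) < l.length := by exact_mod_cast hpos
        set q := min ⌊r (cp + k) * (l.length : ℝ)⌋₊ (l.length - 1) with hq
        have hql : q < l.length := by omega
        have hval := hL2 q l[q] (List.getElem?_eq_getElem hql)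
        have hA'k : A' ⟨k, hk⟩ = some l[q] := by
          rw [hA', Beam.step, pick, ← hl]
          exact List.getElem?_eq_getElem hql
        simp only [exec_bind, exec_readCoin, exec_load, lt, mul, floor, predNat, minNat, exec_op,
          hL1, hposR, decide_true, if_true, exec_store, Nat.floor_natCast, hm.coins, hm.coinPos]
        rw [← hq, hval]
        refine ⟨⟨by dsimp; omega, by dsimp; omega, hm.items, rfl, hm.itemPos,
          by dsimp; omega⟩, fun i => ?_, fun i => ?_⟩
        · by_cases hik : (i : ℕ) = k
          · have : i = ⟨k, hk⟩ := Fin.ext hik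
            subst this
            rw [if_pos (by simp), hA'k]
            simp [HoldsAnchor]
          · have h0 : (i : ℕ) < k + 1 ↔ (i : ℕ) < k := by omega
            have h1 : 6 * (i : ℕ) ≠ 6 * k := by omega
            have h2 : 6 * (i : ℕ) ≠ 6 * k + 1 := by omega
            have h3 : 6 * (i : ℕ) + 1 ≠ 6 * k := by omega
            have h4 : 6 * (i : ℕ) + 1 ≠ 6 * k + 1 := by omega
            have h5 := hA i
            simp only [HoldsAnchor, h0, Function.update_of_ne h1, Function.update_of_ne h2,
              Function.update_of_ne h3, Function.update_of_ne h4]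
            exact h5
        · obtain ⟨h1, h2⟩ := hL i
          have hi3 := hlen i
          refine ⟨?_, fun j y hj => ?_⟩
          · have h3 : 6 * (i : ℕ) + 2 ≠ 6 * k := by omega
            have h4 : 6 * (i : ℕ) + 2 ≠ 6 * k + 1 := by omega
            simpa only [Function.update_of_ne h3, Function.update_of_ne h4] using h1
          · have hj' := (List.getElem?_eq_some_iff.1 hj).1
            have h3 : 6 * (i : ℕ) + 3 + j ≠ 6 * k := by omega
            have h4 : 6 * (i : ℕ) + 3 + j ≠ 6 * k + 1 := by omega
            simpa only [Function.update_of_ne h3, Function.update_of_ne h4] using h2 j y hj)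
  refine ⟨hloop.1, fun i => ?_⟩
  have := hloop.2.1 i
  rwa [if_pos i.isLt] at this

/-- Setup and the two initial divisions cost 2w + 6. An iteration costs at most 6w + 16w + 12w for
the three passes, plus 2 for loop control and reading the number. -/
theorem program_spec (hB : 0 < B) (hw : 0 < w) (s r : ℕ → ℝ) (n : ℕ) :
    (runPhaseA w B s r n).Resources w s r (2 * w + 6 + n * (34 * w + 2)) n (n * w) ∧
      ∀ i : Fin w, (runPhaseA w B s r n).HoldsAnchor i (phaseA w B s r n i) := by
  -- The machine after the two divisions, hence with time 2.
  set m₀ : RAM := ⟨fun _ => 0, 2, 0, s, 0, r, 0⟩ with hm₀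
  have hrun : runPhaseA w B s r n = (exec (do
      setup w (B / 2) (B / w)
      forLoop n fun _ => do
        let s ← readItem
        keepOld w
        placeShifted w (B / 2) (B / w) s
        trim w) m₀).2 := rfl
  rw [hrun, exec_bind]
  have hres : m₀.Resources w s r 2 0 0 := ⟨le_rfl, Nat.zero_le _, rfl, rfl, rfl, rfl⟩
  obtain ⟨m₁, hm₁, hr₁, ha₁⟩ := setup_spec hB hw hres
  rw [← hm₁]
  refine exec_forLoop_induct
    (fun k m => m.Resources w s r (2 * w + 6 + k * (34 * w + 2)) k (k * w) ∧
      ∀ i : Fin w, m.HoldsAnchor i (phaseA w B s r k i))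
    ⟨⟨by have := hr₁.time; omega, hr₁.space, hr₁.items, hr₁.coins, hr₁.itemPos,
      by rw [hr₁.coinPos, zero_mul]⟩, ha₁⟩ ?_
  rintro k - m ⟨hm, ha⟩
  simp only [exec_bind, exec_readItem, hm.items, hm.itemPos]
  set m₂ : RAM := { m with time := m.time + 1 + 1, itemPos := k + 1, items := s } with hm₂
  have hr₂ : m₂.Resources w s r (2 * w + 6 + k * (34 * w + 2) + 2) (k + 1) (k * w) :=
    ⟨by have := hm.time; simp only [hm₂]; omega, hm.space, rfl, hm.coins, rfl, hm.coinPos⟩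
  have ha₂ : ∀ i : Fin w, m₂.HoldsAnchor i (phaseA w B s r k i) := ha
  obtain ⟨m₃, hm₃, hr₃, ha₃, hl₃⟩ := keepOld_spec hr₂ ha₂
  rw [← hm₃]
  obtain ⟨m₄, hm₄, hr₄, ha₄, hl₄⟩ :=
    placeShifted_spec hB (phaseA_consistent w B s r k) (s k) hr₃ ha₃ hl₃
  rw [← hm₄]
  obtain ⟨m₅, hm₅, hr₅, ha₅⟩ :=
    trim_spec hB (phaseA_consistent w B s r k) (s k) hr₄ ha₄ hl₄
  rw [← hm₅]
  refine ⟨⟨hr₅.time.trans ?_, hr₅.space, hr₅.items, hr₅.coins, hr₅.itemPos, ?_⟩, ha₅⟩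
  · have : (k + 1) * (34 * w + 2) = k * (34 * w + 2) + (34 * w + 2) := by ring
    omega
  · rw [hr₅.coinPos]
    ring

end Prog

theorem runPhaseA_beam {w : ℕ} {B : ℝ} (hB : 0 < B) (hw : 0 < w) (s r : ℕ → ℝ) (n : ℕ) :
    (runPhaseA w B s r n).beam w = phaseA w B s r n := by
  funext i
  obtain ⟨h0, h1⟩ := (Prog.program_spec hB hw s r n).2 i
  rw [RAM.beam]
  cases h : phaseA w B s r n i with
  | none => rw [if_pos (h0 h)]
  | some a =>
    obtain ⟨h2, h3⟩ := h1 a h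
    rw [if_neg (by rw [h2]; exact one_ne_zero), h3]

/-! ### The potential `(w - N) / N` -/

/-- Both sides equal (w-N)/N minus wF/N times 1/(N+F) and 1/(3K), respectively, and N + F ≤ 3K
because N ≤ 2K and F ≤ K. This produces the rate 1/6. -/
theorem isPotential_ratio (w : ℕ) :
    IsPotential w (1 / 6) fun N => ((w - N : ℕ) : ℝ) / N where
  nonneg N := by positivity
  full := by simp
  decay N K F hN hNw hNK hKN hFK hNF := by
    have hn : (0 : ℝ) < N := by exact_mod_cast hN
    have hk : (0 : ℝ) < K := by exact_mod_cast (by omega : 0 < K)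
    have hu : (0 : ℝ) < w - N := by
      have : (N : ℝ) < w := by exact_mod_cast hNw
      linarith
    have h3 : (N : ℝ) + F ≤ 3 * K := by exact_mod_cast (by omega : N + F ≤ 3 * K)
    have hf : (0 : ℝ) ≤ F := Nat.cast_nonneg F
    have hw : (0 : ℝ) ≤ w := Nat.cast_nonneg w
    rw [Nat.cast_sub hNF, Nat.cast_sub hNw.le, Nat.cast_add]
    have h1 : ((w : ℝ) - N) / N * (1 - 2 * w * (1 / 6) * F / (K * (w - N))) =
        (w - N) / N - w * F / N * (1 / (3 * K)) := by
      field_simp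
      ring
    have h2 : ((w : ℝ) - (N + F)) / (N + F) = (w - N) / N - w * F / N * (1 / (N + F)) := by
      field_simp
      ring
    rw [h1, h2]
    gcongr

/-! ### The potential `√(w - N) N ^ (-6/7)` -/

theorem rpow_three_halves_le : (3 / 2 : ℝ) ^ (-(6 / 7) : ℝ) ≤ 7065 / 10000 := by
  rw [← pow_le_pow_iff_left₀ (by positivity) (by norm_num) (by norm_num : 7 ≠ 0),
    ← Real.rpow_natCast, ← Real.rpow_mul (by norm_num)]
  have h : (-(6 / 7) * (7 : ℕ) : ℝ) = ((-6 : ℤ) : ℝ) := by norm_num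
  rw [h, Real.rpow_intCast]
  norm_num

/-- A chord bound for a convex function on [0, 1/2], obtained by using Bernoulli's inequality with
exponent 2f ≤ 1 twice. The slope is 2(1 - 0.7065), where 0.7065 bounds the value at the right
endpoint. -/
theorem one_add_rpow_le {f : ℝ} (h0 : 0 ≤ f) (h1 : f ≤ 1 / 2) :
    (1 + f) ^ (-(6 / 7) : ℝ) ≤ 1 - 587 / 1000 * f := by
  have h2 : (3 / 2 : ℝ) ^ (2 * f) ≤ 1 + f := by
    have := rpow_one_add_le_one_add_mul_self (s := 1 / 2) (by norm_num)
      (p := 2 * f) (by linarith) (by linarith)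
    norm_num at this ⊢
    linarith
  calc (1 + f) ^ (-(6 / 7) : ℝ) ≤ ((3 / 2 : ℝ) ^ (2 * f)) ^ (-(6 / 7) : ℝ) :=
        Real.rpow_le_rpow_of_nonpos (by positivity) h2 (by norm_num)
    _ = ((3 / 2 : ℝ) ^ (-(6 / 7) : ℝ)) ^ (2 * f) := by
        rw [← Real.rpow_mul (by norm_num), ← Real.rpow_mul (by norm_num), mul_comm]
    _ ≤ (7065 / 10000 : ℝ) ^ (2 * f) :=
        Real.rpow_le_rpow (by positivity) rpow_three_halves_le (by linarith)
    _ ≤ 1 - 587 / 1000 * f := by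
        have := rpow_one_add_le_one_add_mul_self (s := -(2935 / 10000)) (by norm_num)
          (p := 2 * f) (by linarith) (by linarith)
        norm_num at this ⊢
        linarith

/-- With c = 1 - 0.587f, AM-GM gives √(1-g)·c ≤ ((1-g) + c²)/2, and c² ≤ 1 - f for f ≤ 1/2. The
exponent 6/7 is large enough for this last inequality. -/
theorem sqrt_mul_one_add_rpow_le {f g : ℝ} (h0 : 0 ≤ f) (h1 : f ≤ 1 / 2) (hg : g ≤ 1) :
    √(1 - g) * (1 + f) ^ (-(6 / 7) : ℝ) ≤ 1 - f / 2 - g / 2 := by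
  have h2 := one_add_rpow_le h0 h1
  have h3 : (1 - 587 / 1000 * f) ^ 2 ≤ 1 - f := by nlinarith
  have h4 := Real.sq_sqrt (sub_nonneg.2 hg)
  nlinarith [sq_nonneg (√(1 - g) - (1 - 587 / 1000 * f)),
    mul_le_mul_of_nonneg_left h2 (Real.sqrt_nonneg (1 - g))]

theorem sqrt_mul_rpow_decay {n W x : ℝ} (hn : 0 < n) (hW : n < W) (h0 : 0 ≤ x) (hx : x ≤ n / 2)
    (hxW : x ≤ W - n) :
    √(W - (n + x)) * (n + x) ^ (-(6 / 7) : ℝ) ≤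
      √(W - n) * n ^ (-(6 / 7) : ℝ) * (1 - W * x / (2 * n * (W - n))) := by
  have hu : 0 < W - n := by linarith
  have h1 : W - (n + x) = (W - n) * (1 - x / (W - n)) := by
    field_simp
    ring
  have h2 : n + x = n * (1 + x / n) := by
    field_simp
  have h3 : 1 - W * x / (2 * n * (W - n)) = 1 - x / n / 2 - x / (W - n) / 2 := by
    field_simp
    ring
  have h4 : 0 ≤ x / n := by positivity
  rw [h1, Real.sqrt_mul hu.le, h3, h2, Real.mul_rpow hn.le (by linarith)]
  have h5 := sqrt_mul_one_add_rpow_le (f := x / n) (g := x / (W - n)) h4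
    (by rw [div_le_iff₀ hn]; linarith) (by rw [div_le_one hu]; exact hxW)
  calc √(W - n) * √(1 - x / (W - n)) * (n ^ (-(6 / 7) : ℝ) * (1 + x / n) ^ (-(6 / 7) : ℝ))
      = √(W - n) * n ^ (-(6 / 7) : ℝ) *
          (√(1 - x / (W - n)) * (1 + x / n) ^ (-(6 / 7) : ℝ)) := by ring
    _ ≤ _ := by gcongr

theorem isPotential_sqrt (w : ℕ) :
    IsPotential w (1 / 8) fun N => √((w : ℝ) - N) * (N : ℝ) ^ (-(6 / 7) : ℝ) where
  nonneg N := by positivity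
  full := by simp
  decay N K F hN hNw hNK hKN hFK hNF := by
    have hn : (0 : ℝ) < N := by exact_mod_cast hN
    have hk : (0 : ℝ) < K := by exact_mod_cast (by omega : 0 < K)
    have hw : (N : ℝ) < w := by exact_mod_cast hNw
    have hu : (0 : ℝ) < w - N := by linarith
    have hf : (0 : ℝ) ≤ F := Nat.cast_nonneg F
    have hnf : (N : ℝ) + F ≤ w := by exact_mod_cast hNF
    have hnk : (N : ℝ) ≤ 2 * K := by exact_mod_cast hNK
    have hfk : (F : ℝ) ≤ K := by exact_mod_cast hFK
    rw [Nat.cast_add]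
    have hmul : 0 ≤ √((w : ℝ) - N) * (N : ℝ) ^ (-(6 / 7) : ℝ) := by positivity
    rcases le_total (F : ℝ) (N / 2) with h | h
    · refine (sqrt_mul_rpow_decay hn hw hf h (by linarith)).trans ?_
      refine mul_le_mul_of_nonneg_left ?_ hmul
      have : 2 * w * (1 / 8) * F / (K * (w - N)) ≤ (w : ℝ) * F / (2 * N * (w - N)) := by
        rw [show 2 * (w : ℝ) * (1 / 8) * F / (K * (w - N)) = w * F / (2 * (2 * K) * (w - N)) by
          field_simp; ring]
        gcongr
      linarith
    -- Beyond N/2 the chord bound is unavailable. The potential is decreasing, so its value at N +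
    -- N/2 is an upper bound, and F ≤ K shows that the decrease reached there suffices.
    · have h1 := sqrt_mul_rpow_decay hn hw (x := N / 2) (by linarith) le_rfl (by linarith)
      calc √((w : ℝ) - (N + F)) * ((N : ℝ) + F) ^ (-(6 / 7) : ℝ)
          ≤ √((w : ℝ) - (N + N / 2)) * ((N : ℝ) + N / 2) ^ (-(6 / 7) : ℝ) := by
            have h2 : ((N : ℝ) + F) ^ (-(6 / 7) : ℝ) ≤ ((N : ℝ) + N / 2) ^ (-(6 / 7) : ℝ) :=
              Real.rpow_le_rpow_of_nonpos (by linarith) (by linarith) (by norm_num)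
            gcongr
        _ ≤ _ := h1
        _ ≤ _ := by
            refine mul_le_mul_of_nonneg_left ?_ hmul
            have h3 : 2 * w * (1 / 8) * F / (K * (w - N)) = (F / K) * (w / (4 * ((w : ℝ) - N))) := by
              field_simp
              ring
            have h4 : w * ((N : ℝ) / 2) / (2 * N * (w - N)) = 1 * (w / (4 * ((w : ℝ) - N))) := by
              field_simp
              norm_num
            have h5 : (F : ℝ) / K ≤ 1 := (div_le_one hk).2 hfk
            rw [h3, h4]
            gcongr

/-- The value of a potential at `1` may be lowered as long as the inequality between the values at
`1` and `2` remains true. -/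
theorem IsPotential.update_one {w : ℕ} (hw : 3 ≤ w) {V : ℕ → ℝ} (hV : IsPotential w (1 / 8) V) :
    IsPotential w (1 / 8)
      (Function.update V 1 (V 2 * (4 * ((w : ℝ) - 1) / (3 * w - 4)))) where
  nonneg N := by
    have hw' : (3 : ℝ) ≤ w := by exact_mod_cast hw
    rcases eq_or_ne N 1 with rfl | h
    · rw [Function.update_self]
      exact mul_nonneg (hV.nonneg 2) (div_nonneg (by linarith) (by linarith))
    · rw [Function.update_of_ne h]
      exact hV.nonneg N
  full := by rw [Function.update_of_ne (by omega), hV.full]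
  decay N K F hN hNw hNK hKN hFK hNF := by
    have hw' : (3 : ℝ) ≤ w := by exact_mod_cast hw
    rcases Nat.eq_zero_or_pos F with rfl | hF
    · simp
    rcases eq_or_ne N 1 with rfl | h
    · obtain rfl : K = 1 := by omega
      obtain rfl : F = 1 := by omega
      rw [Function.update_self, Function.update_of_ne (by norm_num)]
      refine le_of_eq ?_
      have h1 : (w : ℝ) - 1 ≠ 0 := by linarith
      have h2 : 3 * (w : ℝ) - 4 ≠ 0 := by linarith
      have h3 : 1 - 2 * w * (1 / 8) * ((1 : ℕ) : ℝ) / (((1 : ℕ) : ℝ) * (w - ((1 : ℕ) : ℝ))) =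
          (3 * w - 4) / (4 * (w - 1)) := by
        push_cast
        field_simp
        ring
      rw [h3, mul_assoc, div_mul_div_cancel₀ h2, div_self (by simpa using h1), mul_one]
    · rw [Function.update_of_ne h, Function.update_of_ne (by omega)]
      exact hV.decay N K F hN hNw hNK hKN hFK hNF

/-! ### Potentials with a good initial value -/

/-- A computable lower bound for `jHalf w`. -/
def jHalfBound (w : ℕ) : ℕ :=
  Nat.findGreatest (fun k => 2719 ^ k ≤ (w - 1) ^ 4 * 1000 ^ k) 20

theorem le_jHalf {w k : ℕ} (hw : 2 ≤ w) (h : 2719 ^ k ≤ (w - 1) ^ 4 * 1000 ^ k) :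
    k ≤ jHalf w := by
  have hx : (0 : ℝ) < (w : ℝ) - 1 := by
    have : (2 : ℝ) ≤ w := by exact_mod_cast hw
    linarith
  have h' : (2719 : ℝ) ^ k ≤ ((w : ℝ) - 1) ^ 4 * 1000 ^ k := by
    have := Nat.cast_le (α := ℝ).2 h
    push_cast [Nat.cast_sub (by omega : 1 ≤ w)] at this
    exact this
  have hexp : Real.exp k ≤ ((w : ℝ) - 1) ^ 4 := by
    calc Real.exp k = Real.exp 1 ^ k := by rw [← Real.exp_nat_mul, mul_one]
      _ ≤ (2719 / 1000 : ℝ) ^ k := by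
        have := Real.exp_one_lt_d9
        gcongr
        linarith
      _ ≤ _ := by
        rw [div_pow, div_le_iff₀ (by positivity)]
        exact h'
  refine Nat.le_floor ?_
  have := (Real.le_log_iff_exp_le (by positivity)).2 hexp
  rwa [Real.log_pow] at this

theorem jHalfBound_le {w : ℕ} (hw : 2 ≤ w) : jHalfBound w ≤ jHalf w := by
  refine le_jHalf hw (Nat.findGreatest_spec (m := 0) (P := fun k => 2719 ^ k ≤ (w - 1) ^ 4 * 1000 ^ k)
    (n := 20) (by omega) ?_)
  simpa using Nat.one_le_pow _ _ (by omega)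

/-- The 14th power of the inequality in `initial_le_jHalf`, cleared of denominators: 14 removes both
the square root and the sevenths in the exponents. What remains is a finite check in integers. -/
theorem initial_pow_le : ∀ w < 129, 3 ≤ w →
    (w - 2) ^ 7 * (4 * (w - 1)) ^ 14 * (w - 1) ^ 12 * 2 ^ 14 * 7 ^ (14 * jHalfBound w) ≤
      2 ^ 12 * (3 * w - 4) ^ 14 * w ^ 14 * 8 ^ (14 * jHalfBound w) := by
  decide +kernel

theorem initial_le_jHalf {w : ℕ} (h3 : 3 ≤ w) (h : w < 129) :
    √((w : ℝ) - 2) * 2 ^ (-(6 / 7) : ℝ) * (4 * ((w : ℝ) - 1) / (3 * w - 4)) *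
      ((w : ℝ) - 1) ^ (6 / 7 : ℝ) ≤ w / 2 * (8 / 7) ^ jHalf w := by
  have hw : (3 : ℝ) ≤ w := by exact_mod_cast h3
  have hx : (0 : ℝ) < (w : ℝ) - 1 := by linarith
  have hy : (0 : ℝ) ≤ (w : ℝ) - 2 := by linarith
  have hz : (0 : ℝ) < 3 * (w : ℝ) - 4 := by linarith
  refine le_trans ?_ (mul_le_mul_of_nonneg_left
    (pow_le_pow_right₀ (by norm_num) (jHalfBound_le (by omega))) (by positivity))
  rw [← pow_le_pow_iff_left₀ (by positivity) (by positivity) (by norm_num : 14 ≠ 0)]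
  have h1 : √((w : ℝ) - 2) ^ 14 = ((w : ℝ) - 2) ^ 7 := by
    rw [show 14 = 2 * 7 from rfl, pow_mul, Real.sq_sqrt hy]
  have h2 : ((2 : ℝ) ^ (-(6 / 7) : ℝ)) ^ 14 = (2 ^ 12)⁻¹ := by
    rw [← Real.rpow_natCast, ← Real.rpow_mul (by norm_num),
      show (-(6 / 7) * (14 : ℕ) : ℝ) = -((12 : ℕ) : ℝ) by norm_num, Real.rpow_neg (by norm_num),
      Real.rpow_natCast]
  have h4 : (((w : ℝ) - 1) ^ (6 / 7 : ℝ)) ^ 14 = ((w : ℝ) - 1) ^ 12 := by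
    rw [← Real.rpow_natCast, ← Real.rpow_mul hx.le,
      show (6 / 7 * (14 : ℕ) : ℝ) = ((12 : ℕ) : ℝ) by norm_num, Real.rpow_natCast]
  have h5 : ((w : ℝ) / 2 * (8 / 7) ^ jHalfBound w) ^ 14 =
      w ^ 14 * 8 ^ (14 * jHalfBound w) / (2 ^ 14 * 7 ^ (14 * jHalfBound w)) := by
    rw [mul_pow, div_pow, div_pow, div_pow, ← pow_mul, ← pow_mul, mul_comm _ 14, div_mul_div_comm]
  rw [mul_pow, mul_pow, mul_pow, h1, h2, h4, h5, div_pow, le_div_iff₀ (by positivity)]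
  have h6 := Nat.cast_le (α := ℝ).2 (initial_pow_le w h h3)
  push_cast [Nat.cast_sub (by omega : 1 ≤ w), Nat.cast_sub (by omega : 2 ≤ w),
    Nat.cast_sub (by omega : 4 ≤ 3 * w)] at h6
  have h7 : ((w : ℝ) - 2) ^ 7 * (2 ^ 12)⁻¹ * ((4 * ((w : ℝ) - 1)) ^ 14 / (3 * w - 4) ^ 14) *
      ((w : ℝ) - 1) ^ 12 * (2 ^ 14 * 7 ^ (14 * jHalfBound w)) =
      ((w : ℝ) - 2) ^ 7 * (4 * ((w : ℝ) - 1)) ^ 14 * ((w : ℝ) - 1) ^ 12 * 2 ^ 14 *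
        7 ^ (14 * jHalfBound w) / (2 ^ 12 * (3 * w - 4) ^ 14) := by
    rw [div_eq_mul_inv, div_eq_mul_inv, mul_inv]
    ring
  rw [h7, div_le_iff₀ (by positivity)]
  linarith

/-- Two terms of the series for log((1+x)/(1-x)) at x = 1/15. They suffice for the constant 7.489.
-/
theorem log_eight_sevenths_ge : (2 * (1 / 15 + (1 / 15) ^ 3 / 3) : ℝ) ≤ Real.log (8 / 7) := by
  have h := Real.hasSum_log_sub_log_of_abs_lt_one (x := 1 / 15) (by norm_num [abs_of_pos])
  have h1 := sum_le_hasSum (Finset.range 2) (fun k _ => by positivity) h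
  rw [← Real.log_div (by norm_num) (by norm_num)] at h1
  norm_num [Finset.sum_range_succ] at h1 ⊢
  exact h1

theorem rpow_le_jHalf {w : ℕ} (hw : 129 ≤ w) :
    ((w : ℝ) - 1) ^ (19 / 14 : ℝ) ≤ w / 2 * (8 / 7) ^ jHalf w := by
  have hw' : (129 : ℝ) ≤ w := by exact_mod_cast hw
  have hx : (0 : ℝ) < (w : ℝ) - 1 := by linarith
  set x := (w : ℝ) - 1 with hxdef
  have h128 : 128 ≤ x := by linarith
  have hJ : 4 * Real.log x - 1 ≤ jHalf w := (Nat.sub_one_lt_floor _).le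
  have hlog : 0 ≤ Real.log x := Real.log_nonneg (by linarith)
  have hl := log_eight_sevenths_ge
  -- The factor 7/8 pays for rounding 4 log x down, and 37/70 is a rational lower bound for 4
  -- log(8/7).
  have h1 : 7 / 8 * x ^ (37 / 70 : ℝ) ≤ (8 / 7) ^ jHalf w := by
    calc 7 / 8 * x ^ (37 / 70 : ℝ)
        = Real.exp (37 / 70 * Real.log x - Real.log (8 / 7)) := by
          rw [Real.exp_sub, Real.exp_log (by norm_num), Real.rpow_def_of_pos hx,
            mul_comm (Real.log x)]
          ring
      _ ≤ Real.exp (jHalf w * Real.log (8 / 7)) := by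
          rw [Real.exp_le_exp]
          have h2 : (4 * Real.log x - 1) * Real.log (8 / 7) ≤ jHalf w * Real.log (8 / 7) :=
            mul_le_mul_of_nonneg_right hJ (Real.log_nonneg (by norm_num))
          nlinarith
      _ = (8 / 7) ^ jHalf w := by
          rw [Real.exp_nat_mul, Real.exp_log (by norm_num)]
  -- The spare exponent 6/35 = 37/70 - 5/14 must absorb the rounding factor 8/7 and the 2 from `w /
  -- 2`. At x = 128 = 2^7 it yields 2^(6/5) > 16/7, whence the threshold 129.
  have h3 : (16 / 7 : ℝ) ≤ x ^ (6 / 35 : ℝ) := by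
    refine le_trans ?_ (Real.rpow_le_rpow (by norm_num) h128 (by norm_num))
    have h4 : (128 : ℝ) = 2 ^ (7 : ℝ) := by norm_num
    rw [h4, ← Real.rpow_mul (by norm_num),
      ← pow_le_pow_iff_left₀ (by positivity) (by positivity) (by norm_num : 5 ≠ 0),
      ← Real.rpow_natCast (2 ^ _), ← Real.rpow_mul (by norm_num)]
    norm_num
  have h5 : x ^ (19 / 14 : ℝ) = x * x ^ (5 / 14 : ℝ) := by
    rw [← Real.rpow_one_add' hx.le (by norm_num)]
    norm_num
  have h6 : x ^ (37 / 70 : ℝ) = x ^ (5 / 14 : ℝ) * x ^ (6 / 35 : ℝ) := by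
    rw [← Real.rpow_add hx]
    norm_num
  rw [h6] at h1
  rw [h5]
  have h7 : 0 < x ^ (5 / 14 : ℝ) := by positivity
  calc x * x ^ (5 / 14 : ℝ) = x / 2 * (7 / 8 * (x ^ (5 / 14 : ℝ) * (16 / 7))) := by ring
    _ ≤ w / 2 * (7 / 8 * (x ^ (5 / 14 : ℝ) * x ^ (6 / 35 : ℝ))) := by
        gcongr
        linarith
    _ ≤ _ := by gcongr

theorem exists_isPotential {w : ℕ} (hw : 2 ≤ w) :
    ∃ (V : ℕ → ℝ) (c : ℝ), IsPotential w (1 / 8) V ∧ 0 < c ∧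
      (∀ N, 1 ≤ N → N < w → c ≤ V N) ∧ V 1 / c ≤ w / 2 * (8 / 7) ^ jHalf w := by
  have hw' : (2 : ℝ) ≤ w := by exact_mod_cast hw
  have hx : (0 : ℝ) < (w : ℝ) - 1 := by linarith
  have hV := isPotential_sqrt w
  set V : ℕ → ℝ := fun N => √((w : ℝ) - N) * (N : ℝ) ^ (-(6 / 7) : ℝ) with hVdef
  set c := ((w : ℝ) - 1) ^ (-(6 / 7) : ℝ) with hc
  have hc0 : 0 < c := by positivity
  have hcV : ∀ N, 1 ≤ N → N < w → c ≤ V N := fun N hN hNw => by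
    have h1 : (1 : ℝ) ≤ N := by exact_mod_cast hN
    have h2 : (N : ℝ) + 1 ≤ w := by exact_mod_cast hNw
    have h3 : c ≤ (N : ℝ) ^ (-(6 / 7) : ℝ) :=
      Real.rpow_le_rpow_of_nonpos (by linarith) (by linarith) (by norm_num)
    have h4 : 1 ≤ √((w : ℝ) - N) := Real.one_le_sqrt.2 (by linarith)
    calc c = 1 * c := (one_mul _).symm
      _ ≤ _ := by
        simp only [hVdef]
        gcongr
  have hV1 : V 1 / c = ((w : ℝ) - 1) ^ (19 / 14 : ℝ) := by
    simp only [hVdef, hc]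
    rw [Nat.cast_one, Real.one_rpow, mul_one, Real.sqrt_eq_rpow, ← Real.rpow_sub hx]
    norm_num
  rcases lt_or_ge w 129 with h | h
  · rcases hw.lt_or_eq with h3 | rfl
    · have h3' : (3 : ℝ) ≤ w := by exact_mod_cast h3
      -- The unmodified V(1) is replaced by the value that makes the step from 1 to 2 an equality.
      -- It is at least V(2), so the lower bound `c` survives.
      refine ⟨_, c, hV.update_one h3, hc0, fun N hN hNw => ?_, ?_⟩
      · rcases eq_or_ne N 1 with rfl | h1
        · rw [Function.update_self]
          refine (hcV 2 (by norm_num) h3).trans (le_mul_of_one_le_right (hV.nonneg 2) ?_)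
          rw [one_le_div (by linarith)]
          linarith
        · rw [Function.update_of_ne h1]
          exact hcV N hN hNw
      · refine le_trans (le_of_eq ?_) (initial_le_jHalf h3 h)
        rw [Function.update_self, hc, Real.rpow_neg hx.le, div_inv_eq_mul]
        simp only [hVdef, Nat.cast_ofNat]
    -- For w = 2 the lowered V(1) would be 0, since V(2) = 0. The original potential works, with
    -- both sides of the final inequality equal to 1.
    · refine ⟨V, c, hV, hc0, hcV, ?_⟩
      rw [hV1]
      norm_num [jHalf]
  · refine ⟨V, c, hV, hc0, hcV, ?_⟩
    rw [hV1]
    exact rpow_le_jHalf h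

/-! ### Iteration counts -/

theorem tDelta_pow_le {w : ℕ} (hw : 2 ≤ w) {δ : ℝ} (h0 : 0 < δ) :
    (7 / 8 : ℝ) ^ tDelta w δ ≤ 2 * δ / w := by
  have hw' : (2 : ℝ) ≤ w := by exact_mod_cast hw
  have hl : 0 < Real.log (8 / 7) := Real.log_pos (by norm_num)
  have h1 : Real.log (w / (2 * δ)) ≤ tDelta w δ * Real.log (8 / 7) := by
    rw [← div_le_iff₀ hl]
    exact Nat.le_ceil _
  have h2 : (w : ℝ) / (2 * δ) ≤ (8 / 7) ^ tDelta w δ := by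
    rw [← Real.log_pow, Real.log_le_log_iff (by positivity) (by positivity)] at h1
    exact h1
  rw [show (7 / 8 : ℝ) = (8 / 7)⁻¹ by norm_num, inv_pow,
    show 2 * δ / (w : ℝ) = (w / (2 * δ))⁻¹ by rw [inv_div]]
  gcongr

theorem log_div_two_mul {w : ℕ} (hw : 2 ≤ w) {δ : ℝ} (h0 : 0 < δ) :
    Real.log (w / (2 * δ)) = Real.log w + Real.log (1 / δ) - Real.log 2 := by
  have hw' : (2 : ℝ) ≤ w := by exact_mod_cast hw
  rw [Real.log_div (by positivity) (by positivity), Real.log_mul (by norm_num) h0.ne', one_div,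
    Real.log_inv]
  ring

theorem jDelta_le {w : ℕ} (hw : 2 ≤ w) {δ : ℝ} (h0 : 0 < δ) (h1 : δ < 1) :
    (jDelta w δ : ℝ) ≤ 4 * Real.log w + Real.log (w / (2 * δ)) / Real.log (8 / 7) + 1 := by
  have hw' : (2 : ℝ) ≤ w := by exact_mod_cast hw
  have hl : 0 < Real.log (8 / 7) := Real.log_pos (by norm_num)
  have h2 : (jHalf w : ℝ) ≤ 4 * Real.log w := by
    refine (Nat.floor_le (mul_nonneg (by norm_num) (Real.log_nonneg (by linarith)))).trans ?_
    have : Real.log ((w : ℝ) - 1) ≤ Real.log w := Real.log_le_log (by linarith) (by linarith)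
    linarith
  have h3 : (tDelta w δ : ℝ) < Real.log (w / (2 * δ)) / Real.log (8 / 7) + 1 := by
    refine Nat.ceil_lt_add_one (div_nonneg (Real.log_nonneg ?_) hl.le)
    rw [one_le_div (by positivity)]
    linarith
  rw [jDelta]
  push_cast
  linarith

theorem jDelta_bound_le {w : ℕ} (hw : 2 ≤ w) {δ : ℝ} (h0 : 0 < δ) :
    4 * Real.log w + Real.log (w / (2 * δ)) / Real.log (8 / 7) + 1 ≤
      (4 + 1 / Real.log (8 / 7)) * Real.log w + Real.log (1 / δ) / Real.log (8 / 7) + 1 := by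
  have hl : 0 < Real.log (8 / 7) := Real.log_pos (by norm_num)
  have h2 : 0 ≤ Real.log 2 / Real.log (8 / 7) :=
    div_nonneg (Real.log_nonneg (by norm_num)) hl.le
  rw [log_div_two_mul hw h0, sub_div, add_div]
  have h3 : (4 + 1 / Real.log (8 / 7)) * Real.log w =
      4 * Real.log w + Real.log w / Real.log (8 / 7) := by ring
  linarith

theorem jDelta_bound_numeric {w : ℕ} (hw : 2 ≤ w) {δ : ℝ} (h0 : 0 < δ) (h1 : δ < 1) :
    (4 + 1 / Real.log (8 / 7)) * Real.log w + Real.log (1 / δ) / Real.log (8 / 7) + 1 ≤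
      11.489 * Real.log w + 7.489 * Real.log (1 / δ) + 1 := by
  have hw' : (2 : ℝ) ≤ w := by exact_mod_cast hw
  have hl := log_eight_sevenths_ge
  have hl0 : 0 < Real.log (8 / 7) := Real.log_pos (by norm_num)
  have h2 : 1 / Real.log (8 / 7) ≤ 7.489 := by
    rw [div_le_iff₀ hl0]
    norm_num at hl ⊢
    linarith
  have h3 : 0 ≤ Real.log w := Real.log_nonneg (by linarith)
  have h4 : 0 ≤ Real.log (1 / δ) := Real.log_nonneg (by rw [one_le_div h0]; exact h1.le)
  have h5 := mul_le_mul_of_nonneg_right h2 h3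
  have h6 := mul_le_mul_of_nonneg_right h2 h4
  rw [div_eq_mul_one_div (Real.log (1 / δ))]
  linarith

theorem log_le_logb_two {x : ℝ} (hx : 1 ≤ x) : Real.log x ≤ Real.logb 2 x := by
  rw [Real.logb, le_div_iff₀ (Real.log_pos (by norm_num))]
  have h := Real.log_two_lt_d9
  nlinarith [Real.log_nonneg hx]

/-! ### Probability and resource bounds -/

section Bounds

variable {w : ℕ} {B : ℝ}

theorem prob_le_of_jDelta_le {Ω : Type u} [MeasurableSpace Ω] {P : Measure Ω}
    [IsProbabilityMeasure P] {s r : ℕ → Ω → ℝ} (hw : 2 ≤ w) (hB : 0 < B)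
    (h : IsPhaseAInput P B s r) {δ : ℝ} (h0 : 0 < δ) {j : ℕ} (hj : jDelta w δ ≤ j) :
    P.real {ω | (phaseA w B (fun k => s k ω) (fun k => r k ω) j).anchors.ncard < w} ≤ δ := by
  have hw' : (2 : ℝ) ≤ w := by exact_mod_cast hw
  obtain ⟨V, c, hV, hc, hVc, h1⟩ := exists_isPotential hw
  refine (hV.prob_le hB (by omega) (by norm_num) h hc hVc j).trans ?_
  have h2 : 0 ≤ V 1 / c := div_nonneg (hV.nonneg 1) hc.le
  have h3 : (1 - 1 / 8 : ℝ) ^ j ≤ (7 / 8) ^ jHalf w * (2 * δ / w) := by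
    calc (1 - 1 / 8 : ℝ) ^ j = (7 / 8) ^ j := by norm_num
      _ ≤ (7 / 8) ^ jDelta w δ := pow_le_pow_of_le_one (by norm_num) (by norm_num) hj
      _ = (7 / 8) ^ jHalf w * (7 / 8) ^ tDelta w δ := by rw [jDelta, pow_add]
      _ ≤ _ := by
        gcongr
        exact tDelta_pow_le hw h0
  rw [mul_div_assoc]
  calc (1 - 1 / 8 : ℝ) ^ j * (V 1 / c)
      ≤ (7 / 8) ^ jHalf w * (2 * δ / w) * (w / 2 * (8 / 7) ^ jHalf w) := by gcongr
    _ = (7 / 8 * (8 / 7)) ^ jHalf w * δ := by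
        rw [mul_pow]
        field_simp
    _ = δ := by norm_num

/-- Amounts to 2^6 ≤ (6/5)^23. The resulting constants 2·23/6 and 23/6 lie below 7.96 and 5.19. -/
theorem two_pow_le_six_fifths_rpow {x : ℝ} (hx : 0 ≤ x) :
    (2 : ℝ) ^ (6 / 23 * x) ≤ (6 / 5) ^ x := by
  rw [Real.rpow_mul (by norm_num)]
  refine Real.rpow_le_rpow (by positivity) ?_ hx
  rw [← pow_le_pow_iff_left₀ (by positivity) (by norm_num) (by norm_num : 23 ≠ 0),
    ← Real.rpow_natCast, ← Real.rpow_mul (by norm_num),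
    show (6 / 23 * (23 : ℕ) : ℝ) = (6 : ℕ) by norm_num, Real.rpow_natCast]
  norm_num

theorem prob_le_of_logb_le {Ω : Type u} [MeasurableSpace Ω] {P : Measure Ω}
    [IsProbabilityMeasure P] {s r : ℕ → Ω → ℝ} (hw : 2 ≤ w) (hB : 0 < B)
    (h : IsPhaseAInput P B s r) {δ : ℝ} (h0 : 0 < δ) (h1 : δ < 1) {j : ℕ}
    (hj : 7.96 * Real.logb 2 w + 5.19 * Real.logb 2 (1 / δ) ≤ j) :
    P.real {ω | (phaseA w B (fun k => s k ω) (fun k => r k ω) j).anchors.ncard < w} ≤ δ := by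
  have hw' : (2 : ℝ) ≤ w := by exact_mod_cast hw
  have hx : (0 : ℝ) < (w : ℝ) - 1 := by linarith
  have hL : 0 ≤ Real.logb 2 w := Real.logb_nonneg (by norm_num) (by linarith)
  have hM : 0 ≤ Real.logb 2 (1 / δ) :=
    Real.logb_nonneg (by norm_num) (by rw [one_le_div h0]; exact h1.le)
  refine ((isPotential_ratio w).prob_le hB (by omega) (by norm_num) h
    (c := 1 / ((w : ℝ) - 1)) (by positivity) (fun N hN hNw => ?_) j).trans ?_
  · have hN' : (1 : ℝ) ≤ N := by exact_mod_cast hN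
    have hNw' : (N : ℝ) + 1 ≤ w := by exact_mod_cast hNw
    rw [Nat.cast_sub hNw.le]
    gcongr <;> linarith
  · have h2 : (w : ℝ) ^ 2 * (1 / δ) ≤ (6 / 5) ^ j := by
      calc (w : ℝ) ^ 2 * (1 / δ)
          = 2 ^ (2 * Real.logb 2 w + Real.logb 2 (1 / δ)) := by
            rw [Real.rpow_add (by norm_num), mul_comm 2, Real.rpow_mul (by norm_num),
              Real.rpow_logb (by norm_num) (by norm_num) (by linarith),
              Real.rpow_logb (by norm_num) (by norm_num) (by positivity)]
            norm_num
        _ ≤ 2 ^ (6 / 23 * (j : ℝ)) := by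
            refine Real.rpow_le_rpow_of_exponent_le (by norm_num) ?_
            linarith
        _ ≤ (6 / 5) ^ (j : ℝ) := two_pow_le_six_fifths_rpow (Nat.cast_nonneg j)
        _ = (6 / 5) ^ j := Real.rpow_natCast _ _
    have h3 : ((1 : ℝ) - 1 / 6) ^ j = ((6 / 5) ^ j)⁻¹ := by
      rw [← inv_pow]
      norm_num
    rw [h3, Nat.cast_sub (by omega : 1 ≤ w), Nat.cast_one, div_one, div_div_eq_mul_div, div_one, mul_assoc,
      inv_mul_le_iff₀ (by positivity)]
    rw [mul_one_div, div_le_iff₀ h0] at h2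
    refine le_trans ?_ h2
    nlinarith

theorem runPhaseA_time_le (hw : 2 ≤ w) (hB : 0 < B) (s r : ℕ → ℝ) (n : ℕ) :
    ((runPhaseA w B s r n).time : ℝ) ≤ 35 * w * (n + 1) := by
  have h := (Prog.program_spec (w := w) hB (by omega) s r n).1.time
  have h2 : 2 * w + 6 + n * (34 * w + 2) ≤ 35 * w * (n + 1) := by nlinarith
  exact_mod_cast h.trans h2

theorem runPhaseA_time_le_log (hw : 2 ≤ w) (hB : 0 < B) (s r : ℕ → ℝ) {δ : ℝ} (h0 : 0 < δ)
    (h1 : δ < 1) {n : ℕ}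
    (hn : (n : ℝ) ≤ 12 * Real.logb 2 w + 12 * Real.logb 2 (1 / δ) + 1) :
    ((runPhaseA w B s r n).time : ℝ) ≤
      490 * (1 + Real.logb 2 (1 / δ)) * (w * Real.logb 2 w) := by
  have hw' : (2 : ℝ) ≤ w := by exact_mod_cast hw
  have hL : 1 ≤ Real.logb 2 w := by
    rw [Real.le_logb_iff_rpow_le (by norm_num) (by linarith), Real.rpow_one]
    exact hw'
  have hM : 0 ≤ Real.logb 2 (1 / δ) :=
    Real.logb_nonneg (by norm_num) (by rw [one_le_div h0]; exact h1.le)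
  -- Uses log₂ w ≥ 1 to absorb the additive 2 and to multiply the term in `δ` by log₂ w.
  have h2 : (n : ℝ) + 1 ≤ 14 * ((1 + Real.logb 2 (1 / δ)) * Real.logb 2 w) := by nlinarith
  calc ((runPhaseA w B s r n).time : ℝ) ≤ 35 * w * (n + 1) := runPhaseA_time_le hw hB s r n
    _ ≤ 35 * w * (14 * ((1 + Real.logb 2 (1 / δ)) * Real.logb 2 w)) := by gcongr
    _ = _ := by ring

end Bounds

/-! ### The main theorem -/

theorem mainTheorem1 :
    ∃ C : ℝ, 0 < C ∧
      ∀ (w : ℕ) (B : ℝ), 2 ≤ w → 0 < B →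
        -- for every input: correctness of the machine, its resources, and the mesh
        (∀ (s r : ℕ → ℝ) (n : ℕ),
          (runPhaseA w B s r n).beam w = phaseA w B s r n ∧
          ((runPhaseA w B s r n).time : ℝ) ≤ C * w * (n + 1) ∧
          ((runPhaseA w B s r n).space : ℝ) ≤ C * w ∧
          (phaseA w B s r n).anchors.ncard ≤ w ∧
          (∀ a ∈ (phaseA w B s r n).anchors,
            ∃ V : Finset ℕ, V ⊆ Finset.range n ∧ a = ∑ k ∈ V, s k) ∧
          ((phaseA w B s r n).anchors.ncard = w →
            (∀ i : Fin w, ∃ a ∈ (phaseA w B s r n).anchors, a ∈ bucket w B i) ∧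
            IsMesh (phaseA w B s r n).anchors B (B / w))) ∧
        -- for random input: all buckets are filled with high probability
        (∀ (Ω : Type u) [MeasurableSpace Ω] (P : Measure Ω) [IsProbabilityMeasure P]
          (s r : ℕ → Ω → ℝ), IsPhaseAInput P B s r →
          ∀ δ : ℝ, 0 < δ → δ < 1 →
            (∀ j : ℕ, jDelta w δ ≤ j →
              P.real {ω | (phaseA w B (fun k => s k ω) (fun k => r k ω) j).anchors.ncard < w}
                ≤ δ) ∧
            (jDelta w δ : ℝ) ≤
              4 * Real.log w + Real.log (w / (2 * δ)) / Real.log (8 / 7) + 1 ∧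
            4 * Real.log w + Real.log (w / (2 * δ)) / Real.log (8 / 7) + 1 ≤
              (4 + 1 / Real.log (8 / 7)) * Real.log w +
                Real.log (1 / δ) / Real.log (8 / 7) + 1 ∧
            (4 + 1 / Real.log (8 / 7)) * Real.log w +
                Real.log (1 / δ) / Real.log (8 / 7) + 1 ≤
              11.489 * Real.log w + 7.489 * Real.log (1 / δ) + 1 ∧
            (∀ ω, ((runPhaseA w B (fun k => s k ω) (fun k => r k ω) (jDelta w δ)).time : ℝ) ≤
              C * (1 + Real.logb 2 (1 / δ)) * (w * Real.logb 2 w)) ∧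
            ∃ j : ℕ,
              (j : ℝ) ≤ 7.96 * Real.logb 2 w + 5.19 * Real.logb 2 (1 / δ) + 1 ∧
              P.real {ω | (phaseA w B (fun k => s k ω) (fun k => r k ω) j).anchors.ncard < w}
                ≤ δ ∧
              ∀ ω, ((runPhaseA w B (fun k => s k ω) (fun k => r k ω) j).time : ℝ) ≤
                C * (1 + Real.logb 2 (1 / δ)) * (w * Real.logb 2 w)) := by
  -- 490 = 35 · 14: the time constant per bucket and iteration times the constant in the bound on
  -- the number of iterations. It also dominates the 6 cells per bucket.
  refine ⟨490, by norm_num, fun w B hw hB => ⟨fun s r n => ?_, ?_⟩⟩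
  · have hw' : (2 : ℝ) ≤ w := by exact_mod_cast hw
    have hcons := phaseA_consistent w B s r n
    have hcard := hcons.ncard_anchors hB
    refine ⟨runPhaseA_beam hB (by omega) s r n, ?_, ?_, ?_, ?_, fun hfull => ?_⟩
    · refine (runPhaseA_time_le hw hB s r n).trans ?_
      gcongr
      norm_num
    · have h : ((runPhaseA w B s r n).space : ℝ) ≤ 6 * w := by
        exact_mod_cast (Prog.program_spec (w := w) hB (by omega) s r n).1.space
      linarith
    · rw [hcard]
      simpa using (phaseA w B s r n).occ.card_le_univ
    · rintro a ⟨i, hi⟩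
      exact exists_subset_sum_of_mem_phaseA w B s r n i a hi
    · have hall : ∀ i : Fin w, ∃ a ∈ (phaseA w B s r n).anchors, a ∈ bucket w B i := by
        intro i
        have huniv : (phaseA w B s r n).occ = Finset.univ :=
          (Finset.card_eq_iff_eq_univ _).1 (by rw [← hcard, hfull, Fintype.card_fin])
        obtain ⟨a, ha⟩ := Beam.mem_occ.1 (huniv ▸ Finset.mem_univ i)
        exact ⟨a, ⟨i, ha⟩, hcons i a ha⟩
      exact ⟨hall, Beam.isMesh_anchors hB (by omega) hall⟩
  · intro Ω _ P _ s r h δ h0 h1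
    have hw' : (1 : ℝ) ≤ w := by exact_mod_cast (by omega : 1 ≤ w)
    have hδ : 1 ≤ 1 / δ := by rw [one_le_div h0]; exact h1.le
    have hL := log_le_logb_two hw'
    have hM := log_le_logb_two hδ
    have hL0 := Real.log_nonneg hw'
    have hM0 := Real.log_nonneg hδ
    have e1 := jDelta_le hw h0 h1
    have e2 := jDelta_bound_le hw h0
    have e3 := jDelta_bound_numeric hw h0 h1
    refine ⟨fun j hj => prob_le_of_jDelta_le hw hB h h0 hj, e1, e2, e3, fun ω => ?_, ?_⟩
    · refine runPhaseA_time_le_log hw hB _ _ h0 h1 ((e1.trans (e2.trans e3)).trans ?_)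
      linarith
    · have hx : (0 : ℝ) ≤ 7.96 * Real.logb 2 w + 5.19 * Real.logb 2 (1 / δ) := by
        have : 0 ≤ Real.logb 2 w := hL0.trans hL
        have : 0 ≤ Real.logb 2 (1 / δ) := hM0.trans hM
        positivity
      have hj := (Nat.ceil_lt_add_one hx).le
      refine ⟨_, hj, prob_le_of_logb_le hw hB h h0 h1 (Nat.le_ceil _), fun ω => ?_⟩
      refine runPhaseA_time_le_log hw hB _ _ h0 h1 (hj.trans ?_)
      linarith
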